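/- Let $V_{\rm per}\colon\mathbb R\to\mathbb R$ be continuous and $1$-periodic, and let $W\colon\mathbb R\to\mathbb R$ be a Borel function with $W\ge 0$ and $$\lim_{R\to+\infty}\frac1R\int_{-R}^{R}W(s)\,ds=0 .$$ For $\varepsilon>0$ and $u\in H^1(0,1)$ put $$F_\varepsilon(u)=\int_0^1\Big(|u'(t)|^2+V_{\rm per}\Big(\frac{u(t)}{\varepsilon}\Big)\Big)dt\in\mathbb R,\qquad G_\varepsilon(u)=\int_0^1\Big(|u'(t)|^2+V_{\rm per}\Big(\frac{u(t)}{\varepsilon}\Big)+W\Big(\frac{u(t)}{\varepsilon}\Big)\Big)dt\in(-\infty,+\infty].$$ Define $f_{\rm hom}\colon\mathbb R\to\mathbb R$ by $f_{\rm hom}(0)=\min V_{\rm per}$ and, for $\xi\ne0$, by the cell formula $$f_{\rm hom}(\xi)=\min\bigg\{|\xi|\int_0^{1/|\xi|}\big(|v'(t)+\xi|^2+V_{\rm per}(v(t)+\xi t)\big)\,dt : v\in H^1_0(0,1/|\xi|)\bigg\},$$ where $H^1_0$ is the closure of $C_c^\infty$ in $H^1$. Then these minima are attained, $f_{\rm hom}(u')$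 is integrable on $(0,1)$ for every $u\in H^1(0,1)$, and, with $$F_{\rm hom}(u)=\int_0^1 f_{\rm hom}(u'(t))\,dt\qquad(u\in H^1(0,1)),$$ one has $$\Gamma\text{-}\lim_{\varepsilon\to0^+}G_\varepsilon=\Gamma\text{-}\lim_{\varepsilon\to0^+}F_\varepsilon=F_{\rm hom}\quad\text{on }H^1(0,1),$$ both with respect to weak convergence in $H^1(0,1)$ and with respect to strong convergence in $L^2(0,1)$. Here a family $E_\varepsilon$ on $H^1(0,1)$ $\Gamma$-converges to $E_0$ if for every sequence $\varepsilon_n\to0^+$ and every $u\in H^1(0,1)$: $E_0(u)\le\liminf_n E_{\varepsilon_n}(u_n)$ for every sequence $u_n\in H^1(0,1)$ converging to $u$, and there is a sequence $u_n\in H^1(0,1)$ converging to $u$ with $\limsup_n E_{\varepsilon_n}(u_n)\le E_0(u)$. -/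

import Mathlib

open Filter Topology MeasureTheory Set
open scoped ENNReal ContDiff

noncomputable section

/-- The Lebesgue space `L²(a,b)` of real functions on the open interval `(a,b)`. -/
abbrev L2Interval (a b : ℝ) : Type := Lp ℝ 2 (volume.restrict (Ioo a b))

/-- The test functions `C_c^∞(a,b)`. -/
structure IsTestFunction (a b : ℝ) (φ : ℝ → ℝ) : Prop where
  smooth : ContDiff ℝ ∞ φ
  compact : HasCompactSupport φ
  support_subset : tsupport φ ⊆ Ioo a b

/-- `g` is the weak derivative of `u` on `(a,b)`. -/
def HasWeakDeriv (a b : ℝ) (u g : L2Interval a b) : Prop :=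
  ∀ φ : ℝ → ℝ, IsTestFunction a b φ →
    ∫ t in Ioo a b, u t * deriv φ t = -∫ t in Ioo a b, g t * φ t

theorem L2Interval.integrable_mul {a b : ℝ} (u : L2Interval a b) {ψ : ℝ → ℝ}
    (hc : Continuous ψ) (hs : HasCompactSupport ψ) :
    Integrable (fun t => u t * ψ t) (volume.restrict (Ioo a b)) :=
  (Lp.memLp u).integrable_mul (q := 2) (hc.memLp_of_hasCompactSupport hs)

theorem IsTestFunction.continuous_deriv {a b : ℝ} {φ : ℝ → ℝ} (h : IsTestFunction a b φ) :
    Continuous (deriv φ) :=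
  h.smooth.continuous_deriv (by simp)

/-- The Hilbert space `H¹(a,b)`: the pairs `(u, u')` in `L²(a,b) × L²(a,b)`, where `u'` is the
weak derivative of `u`, with the norm `(‖u‖² + ‖u'‖²)^(1/2)`. -/
def H1Interval (a b : ℝ) : Submodule ℝ (WithLp 2 (L2Interval a b × L2Interval a b)) where
  carrier := {p | HasWeakDeriv a b p.fst p.snd}
  zero_mem' := by
    intro φ hφ
    have h0 : ((0 : L2Interval a b) : ℝ → ℝ) =ᵐ[volume.restrict (Ioo a b)] 0 :=
      Lp.coeFn_zero _ _ _
    have h (ψ : ℝ → ℝ) : ∫ t in Ioo a b, (0 : L2Interval a b) t * ψ t = 0 := by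
      refine integral_eq_zero_of_ae ?_
      filter_upwards [h0] with t ht
      rw [ht, Pi.zero_apply, zero_mul]
    rw [WithLp.zero_fst, WithLp.zero_snd, h, h, neg_zero]
  add_mem' := by
    intro p q hp hq φ hφ
    have h (u v : L2Interval a b) (ψ : ℝ → ℝ) (hc : Continuous ψ) (hs : HasCompactSupport ψ) :
        ∫ t in Ioo a b, (u + v) t * ψ t
          = (∫ t in Ioo a b, u t * ψ t) + ∫ t in Ioo a b, v t * ψ t := by
      rw [← integral_add (u.integrable_mul hc hs) (v.integrable_mul hc hs)]
      refine integral_congr_ae ?_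
      filter_upwards [Lp.coeFn_add u v] with t ht
      rw [ht, Pi.add_apply, add_mul]
    rw [WithLp.add_fst, WithLp.add_snd, h _ _ _ hφ.continuous_deriv hφ.compact.deriv,
      h _ _ _ hφ.smooth.continuous hφ.compact, hp φ hφ, hq φ hφ, neg_add]
  smul_mem' := by
    intro c p hp φ hφ
    have h (u : L2Interval a b) (ψ : ℝ → ℝ) :
        ∫ t in Ioo a b, (c • u) t * ψ t = c * ∫ t in Ioo a b, u t * ψ t := by
      rw [← integral_const_mul]
      refine integral_congr_ae ?_
      filter_upwards [Lp.coeFn_smul c u] with t ht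
      rw [ht, Pi.smul_apply, smul_eq_mul, mul_assoc]
    rw [WithLp.smul_fst, WithLp.smul_snd, h, h, hp φ hφ, mul_neg]

/-- The underlying function of `u ∈ H¹(a,b)`. -/
def h1Val {a b : ℝ} (u : H1Interval a b) : L2Interval a b := u.1.fst

/-- The derivative `u'` of `u ∈ H¹(a,b)`. -/
def h1Deriv {a b : ℝ} (u : H1Interval a b) : L2Interval a b := u.1.snd

/-- `H¹₀(a,b)`: the closure of `C_c^∞(a,b)` in `H¹(a,b)`. -/
def H10Interval (a b : ℝ) : Set (H1Interval a b) :=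
  closure {u | ∃ φ : ℝ → ℝ, IsTestFunction a b φ ∧ h1Val u =ᵐ[volume.restrict (Ioo a b)] φ}

/-- Weak convergence in `H¹(a,b)`: convergence under every continuous linear functional. -/
def WeakH1Conv (a b : ℝ) (v : ℕ → H1Interval a b) (u : H1Interval a b) : Prop :=
  ∀ l : H1Interval a b →L[ℝ] ℝ, Tendsto (fun n => l (v n)) atTop (𝓝 (l u))

/-- Strong `L²(a,b)` convergence of elements of `H¹(a,b)`. -/
def StrongL2Conv (a b : ℝ) (v : ℕ → H1Interval a b) (u : H1Interval a b) : Prop :=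
  Tendsto (fun n => h1Val (v n)) atTop (𝓝 (h1Val u))

/-- The family `E ε` Γ-converges to `E₀` as `ε → 0⁺` with respect to the sequential convergence
`conv`: along every sequence `ε n → 0⁺` and at every point, the liminf inequality holds and there
is a recovery sequence. -/
def GammaConverges {X : Type*} (conv : (ℕ → X) → X → Prop) (E : ℝ → X → EReal)
    (E₀ : X → EReal) : Prop :=
  ∀ ε : ℕ → ℝ, Tendsto ε atTop (𝓝[>] 0) → ∀ u : X,
    (∀ v : ℕ → X, conv v u → E₀ u ≤ liminf (fun n => E (ε n) (v n)) atTop) ∧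
    ∃ v : ℕ → X, conv v u ∧ limsup (fun n => E (ε n) (v n)) atTop ≤ E₀ u

/-- The unperturbed energy `F_ε(u) = ∫₀¹ (|u'|² + V(u/ε)) dt`. -/
def periodicEnergy (V : ℝ → ℝ) (ε : ℝ) (u : H1Interval 0 1) : ℝ :=
  ∫ t in Ioo (0 : ℝ) 1, (h1Deriv u t ^ 2 + V (h1Val u t / ε))

/-- The perturbed energy `G_ε(u) = ∫₀¹ (|u'|² + V(u/ε) + W(u/ε)) dt`, for `W ≥ 0`. The first two
terms have a finite integral, the third one has an integral in `[0,+∞]`. -/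
def perturbedEnergy (V W : ℝ → ℝ) (ε : ℝ) (u : H1Interval 0 1) : EReal :=
  (periodicEnergy V ε u : EReal) +
    ((∫⁻ t in Ioo (0 : ℝ) 1, ENNReal.ofReal (W (h1Val u t / ε)) : ℝ≥0∞) : EReal)

/-- The functional minimized in the cell problem with slope `ξ ≠ 0`, namely
`|ξ| ∫₀^{1/|ξ|} (|v' + ξ|² + V(v + ξ t)) dt`. -/
def cellEnergy (V : ℝ → ℝ) (ξ : ℝ) (v : H1Interval 0 (1 / |ξ|)) : ℝ :=
  |ξ| * ∫ t in Ioo (0 : ℝ) (1 / |ξ|), ((h1Deriv v t + ξ) ^ 2 + V (h1Val v t + ξ * t))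

open Classical in
/-- The homogenized integrand: `min V` at `0`, and the value of the cell problem at `ξ ≠ 0`. -/
def fhom (V : ℝ → ℝ) (ξ : ℝ) : ℝ :=
  if ξ = 0 then sInf (range V) else sInf (cellEnergy V ξ '' H10Interval 0 (1 / |ξ|))

/-- The homogenized functional `F_hom(u) = ∫₀¹ f_hom(u') dt`. -/
def homogenizedEnergy (V : ℝ → ℝ) (u : H1Interval 0 1) : ℝ :=
  ∫ t in Ioo (0 : ℝ) 1, fhom V (h1Deriv u t)

end

/-!
Write `m = min V` and `c(lam) = 2 ∫₀¹ √(V - lam)` for `lam ≤ m` (`crossingCost`). Everything rests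
on the duality formula `f_hom(ξ) = max {lam + c(lam) |ξ| : lam ≤ m}` (`le_fhom`, `exists_fhom_eq`).

The inequality `≥` is a calibration: since `g² + V(U) - lam ≥ 2 |g| √(V(U) - lam)`, the energy of a
path `U` with derivative `g` is bounded below by `lam` times its duration plus a quantity that
depends on its end points only (`IsPrimitive.le_pathEnergy`). Equality holds for the solutions of
`U' = √(V(U) - lam)`, which are the inverses of the travel time `x ↦ ∫ 1/√(V - lam)`
(`exists_travel`). The cell problem with period `T = 1/|ξ|` is solved by the level `lam` at which
the travel time through one period is `T`; if `T` exceeds all the travel times at levels below `m`,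
then the travel time at the level `m` is finite by Fatou's lemma, and the solution waits at a
minimum point of `V` for the remaining time (`exists_crossing_path`). That the resulting path lies
in `H¹₀` follows from an orthogonality argument (`mem_H10Interval_of_eq_zero`).

For the liminf inequality the calibration is applied on each interval of a uniform partition, with
the level that is optimal for the mean slope of the limit there. As `V` is periodic, the costs `2 ∫
√(V(s/ε) - lam) ds` converge to `c(lam)` times the length, so the energies are asymptotically at
least `∫ f_hom` of the slopes of the piecewise affine interpolation; refining the partition, these
slopes converge a.e., and Fatou's lemma concludes (`homogenizedEnergy_le_of_frequently`).

For the limsup inequality it suffices to treat the larger energies, which contain `W`. As `W` has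
vanishing mean, close to each point there is, for small `ε`, a point at which `V(·/ε)` is almost
minimal and `W(·/ε)` is small (`exists_good_point`). Over a fine partition, such points close to the
graph of `u` are joined by paths that are calibrated at a level `lam ≤ m - η²`, or else wait at such
a point (`exists_connection`). Waiting costs little by the choice of the points, and while
travelling the speed is at least `η`, so the contribution of `W` is at most `1/η` times its
vanishing integral. By Jensen's inequality for the affine minorants of `f_hom`, the energies do not
exceed `∫ f_hom(u')` by more than a small error (`eventually_exists_recovery`); a diagonal sequence
is a recovery sequence.

A bound of the energy bounds the derivatives in `L²`, and for bounded derivatives strong `L²`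
convergence implies weak convergence in `H¹` (`StrongL2Conv.weakH1Conv`); hence both topologies give
the same Γ-limit.
-/


noncomputable section

/-! ### Test functions and the lemma of du Bois-Reymond -/

theorem IsTestFunction.sub_const_mul {a b : ℝ} {φ ψ : ℝ → ℝ} (hφ : IsTestFunction a b φ)
    (hψ : IsTestFunction a b ψ) (c : ℝ) : IsTestFunction a b (fun t => φ t - c * ψ t) where
  smooth := hφ.smooth.sub (contDiff_const.mul hψ.smooth)
  compact := by
    have := hψ.compact.mul_left (f := fun _ => c)
    exact hφ.compact.sub this
  support_subset := by
    refine (tsupport_sub φ (fun t => c * ψ t)).trans (union_subset hφ.support_subset ?_)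
    exact (tsupport_mul_subset_right (f := fun _ => c)).trans hψ.support_subset

theorem IsTestFunction.exists_Icc {a b : ℝ} {φ : ℝ → ℝ} (h : IsTestFunction a b φ) (hab : a < b) :
    ∃ c d, a < c ∧ c ≤ d ∧ d < b ∧ ∀ t, t ∉ Icc c d → φ t = 0 := by
  have hz (t : ℝ) (ht : t ∉ tsupport φ) : φ t = 0 := image_eq_zero_of_notMem_tsupport ht
  rcases (tsupport φ).eq_empty_or_nonempty with he | hne
  · refine ⟨(a + b) / 2, (a + b) / 2, by linarith, le_rfl, by linarith, fun t _ => hz t ?_⟩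
    simp [he]
  · have hc : IsCompact (tsupport φ) := h.compact
    have h1 := h.support_subset (hc.sInf_mem hne)
    have h2 := h.support_subset (hc.sSup_mem hne)
    refine ⟨sInf (tsupport φ), sSup (tsupport φ), h1.1,
      Real.sInf_le_sSup _ hc.bddBelow hc.bddAbove, h2.2, fun t ht => hz t fun hts => ht ?_⟩
    exact ⟨csInf_le hc.bddBelow hts, le_csSup hc.bddAbove hts⟩

/-- A test function with zero mean is the derivative of a test function. -/
theorem IsTestFunction.exists_deriv_eq {a b : ℝ} {ψ : ℝ → ℝ} (h : IsTestFunction a b ψ)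
    (hab : a < b) (h0 : ∫ t in a..b, ψ t = 0) :
    ∃ φ, IsTestFunction a b φ ∧ deriv φ = ψ := by
  obtain ⟨c, d, hac, hcd, hdb, hz⟩ := h.exists_Icc hab
  have hcont := h.smooth.continuous
  have hder (t : ℝ) : HasDerivAt (fun t => ∫ s in a..t, ψ s) (ψ t) t :=
    intervalIntegral.integral_hasDerivAt_right (hcont.intervalIntegrable _ _)
      (hcont.stronglyMeasurableAtFilter _ _) hcont.continuousAt
  have hde : deriv (fun t => ∫ s in a..t, ψ s) = ψ := funext fun t => (hder t).deriv
  have hzero (t : ℝ) (ht : t ∉ Icc c d) : ∫ s in a..t, ψ s = 0 := by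
    rcases lt_or_ge t c with htc | htc
    · refine intervalIntegral.integral_zero_ae (ae_of_all _ fun s hs => hz s fun hs' => ?_)
      have := (mem_uIoc.mp hs)
      rcases this with hh | hh <;> linarith [hh.1, hh.2, hs'.1]
    · have htd : d < t := by
        by_contra hh
        exact ht ⟨htc, not_lt.mp hh⟩
      rw [← intervalIntegral.integral_add_adjacent_intervals (hcont.intervalIntegrable a b)
        (hcont.intervalIntegrable b t), h0, zero_add]
      refine intervalIntegral.integral_zero_ae (ae_of_all _ fun s hs => hz s fun hs' => ?_)
      have := (mem_uIoc.mp hs)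
      rcases this with hh | hh <;> linarith [hh.1, hh.2, hs'.2]
  have hsupp : tsupport (fun t => ∫ s in a..t, ψ s) ⊆ Icc c d :=
    closure_minimal (fun t ht => by_contra fun hn => ht (hzero t hn)) isClosed_Icc
  refine ⟨fun t => ∫ s in a..t, ψ s, ⟨?_, ?_, hsupp.trans (Icc_subset_Ioo hac hdb)⟩, hde⟩
  · rw [contDiff_infty_iff_deriv, hde]
    exact ⟨fun t => (hder t).differentiableAt, h.smooth⟩
  · exact HasCompactSupport.of_support_subset_isCompact isCompact_Icc (subset_closure.trans hsupp)

theorem exists_testFunction_integral_eq_one {a b : ℝ} (hab : a < b) :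
    ∃ ψ, IsTestFunction a b ψ ∧ ∫ t in a..b, ψ t = 1 := by
  let f : ContDiffBump ((a + b) / 2) := ⟨(b - a) / 8, (b - a) / 4, by linarith, by linarith⟩
  have hs : tsupport (f.normed volume) ⊆ Ioo a b := by
    rw [f.tsupport_normed_eq, Real.closedBall_eq_Icc]
    refine Icc_subset_Ioo ?_ ?_ <;> simp only [f] <;> linarith
  refine ⟨f.normed volume, ⟨f.contDiff_normed, f.hasCompactSupport_normed, hs⟩, ?_⟩
  rw [intervalIntegral.integral_of_le hab.le, setIntegral_eq_integral_of_forall_compl_eq_zero,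
    f.integral_normed]
  intro t ht
  exact image_eq_zero_of_notMem_tsupport fun h => ht (Ioo_subset_Ioc_self (hs h))

/-- The lemma of du Bois-Reymond: a function orthogonal to all derivatives of test functions is
constant. -/
theorem exists_ae_eq_const_of_integral_mul_deriv_eq_zero {a b : ℝ} (hab : a < b) {w : ℝ → ℝ}
    (hw : IntegrableOn w (Ioo a b))
    (h : ∀ φ, IsTestFunction a b φ → ∫ t in Ioo a b, w t * deriv φ t = 0) :
    ∃ c : ℝ, w =ᵐ[volume.restrict (Ioo a b)] fun _ => c := by
  obtain ⟨ψ₀, hψ₀, hψ₀1⟩ := exists_testFunction_integral_eq_one hab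
  have hmul {φ : ℝ → ℝ} (hφ : IsTestFunction a b φ) :
      IntegrableOn (fun t => w t * φ t) (Ioo a b) := by
    obtain ⟨C, hC⟩ := hφ.compact.exists_bound_of_continuous hφ.smooth.continuous
    exact Integrable.mul_bdd hw hφ.smooth.continuous.aestronglyMeasurable (ae_of_all _ hC)
  have hint {φ : ℝ → ℝ} (hφ : IsTestFunction a b φ) : IntegrableOn φ (Ioo a b) :=
    (hφ.smooth.continuous.integrable_of_hasCompactSupport hφ.compact).integrableOn
  have hio (φ : ℝ → ℝ) : ∫ t in a..b, φ t = ∫ t in Ioo a b, φ t := by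
    rw [intervalIntegral.integral_of_le hab.le, integral_Ioc_eq_integral_Ioo]
  set c := ∫ t in Ioo a b, w t * ψ₀ t with hc
  refine ⟨c, ?_⟩
  have hconst : IntegrableOn (fun _ : ℝ => c) (Ioo a b) := integrableOn_const (by simp)
  have key := isOpen_Ioo.ae_eq_zero_of_integral_contDiff_smul_eq_zero
    (μ := volume) (f := fun t => w t - c) (hw.sub hconst).locallyIntegrableOn ?_
  · rw [Filter.EventuallyEq, ae_restrict_iff' measurableSet_Ioo]
    filter_upwards [key] with t ht hts
    linarith [ht hts]
  · intro ψ h1 h2 h3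
    have hψ : IsTestFunction a b ψ := ⟨h1, h2, h3⟩
    rw [← setIntegral_eq_integral_of_forall_compl_eq_zero (s := Ioo a b)]
    swap
    · intro t ht
      rw [image_eq_zero_of_notMem_tsupport fun h => ht (h3 h), zero_smul]
    -- subtracting a multiple of `ψ₀` makes the mean of `ψ` vanish
    set I := ∫ t in Ioo a b, ψ t with hI
    have h4 : ∫ t in a..b, (ψ t - I * ψ₀ t) = 0 := by
      rw [hio, integral_sub (hint hψ) ((hint hψ₀).const_mul I), integral_const_mul, ← hio ψ₀,
        hψ₀1, ← hI]
      ring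
    obtain ⟨φ, hφ, hφd⟩ := (hψ.sub_const_mul hψ₀ I).exists_deriv_eq hab h4
    have h5 := h φ hφ
    rw [hφd] at h5
    have h6 : ∫ t in Ioo a b, w t * (ψ t - I * ψ₀ t) = (∫ t in Ioo a b, w t * ψ t) - I * c := by
      rw [hc, ← integral_const_mul, ← integral_sub (hmul hψ) ((hmul hψ₀).const_mul I)]
      exact integral_congr_ae (ae_of_all _ fun t => by ring)
    have h7 : ∫ t in Ioo a b, ψ t • (w t - c) = (∫ t in Ioo a b, w t * ψ t) - c * I := by
      rw [hI, ← integral_const_mul, ← integral_sub (hmul hψ) ((hint hψ).const_mul c)]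
      exact integral_congr_ae (ae_of_all _ fun t => by simp only [smul_eq_mul]; ring)
    rw [h7, ← h5, h6]
    ring

/-! ### Absolutely continuous representatives of `H¹` functions -/

/-- `U` is an absolutely continuous function on `[a,b]` whose derivative `g` belongs to
`L²(a,b)`. These are the pairs `(u, u')` of `H¹(a,b)` with the continuous representative of `u`. -/
structure IsPrimitive (a b : ℝ) (U g : ℝ → ℝ) : Prop where
  memLp : MemLp g 2 (volume.restrict (Ioo a b))
  eq_add_integral : ∀ t ∈ Icc a b, U t = U a + ∫ s in a..t, g s

namespace IsPrimitive

variable {a b c d : ℝ} {U g : ℝ → ℝ}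

theorem intervalIntegrable (h : IsPrimitive a b U g) (hab : a ≤ b) :
    IntervalIntegrable g volume a b :=
  (intervalIntegrable_iff_integrableOn_Ioo_of_le hab).mpr
    (h.memLp.integrable (by norm_num))

theorem intervalIntegrable_sq (h : IsPrimitive a b U g) (hab : a ≤ b) :
    IntervalIntegrable (fun t => g t ^ 2) volume a b :=
  (intervalIntegrable_iff_integrableOn_Ioo_of_le hab).mpr h.memLp.integrable_sq

theorem absolutelyContinuous (h : IsPrimitive a b U g) (hab : a ≤ b) :
    AbsolutelyContinuousOnInterval (fun t => U a + ∫ s in a..t, g s) a b :=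
  (LipschitzWith.const (U a)).lipschitzOnWith.absolutelyContinuousOnInterval.fun_add
    ((h.intervalIntegrable hab).absolutelyContinuousOnInterval_intervalIntegral left_mem_uIcc)

/-- Lebesgue's differentiation theorem. It concerns the primitive that is defined on all of `ℝ`, as
`U` is only known on `[a,b]`. -/
theorem ae_hasDerivAt (h : IsPrimitive a b U g) (hab : a ≤ b) :
    ∀ᵐ t, t ∈ Icc a b → HasDerivAt (fun t => U a + ∫ s in a..t, g s) (g t) t := by
  filter_upwards [(h.intervalIntegrable hab).ae_hasDerivAt_integral] with t ht htm
  rw [uIcc_of_le hab] at ht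
  exact (ht htm a (left_mem_Icc.mpr hab)).const_add (U a)

theorem continuousOn (h : IsPrimitive a b U g) (hab : a ≤ b) : ContinuousOn U (Icc a b) := by
  have := (h.absolutelyContinuous hab).continuousOn
  rw [uIcc_of_le hab] at this
  exact this.congr h.eq_add_integral

theorem sub_eq_integral (h : IsPrimitive a b U g) (hab : a ≤ b) {s t : ℝ} (hs : s ∈ Icc a b)
    (ht : t ∈ Icc a b) : U t - U s = ∫ r in s..t, g r := by
  have hi := h.intervalIntegrable hab
  have hs' : IntervalIntegrable g volume a s :=
    hi.mono_set (by rw [uIcc_of_le hab, uIcc_of_le hs.1]; exact Icc_subset_Icc_right hs.2)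
  have ht' : IntervalIntegrable g volume a t :=
    hi.mono_set (by rw [uIcc_of_le hab, uIcc_of_le ht.1]; exact Icc_subset_Icc_right ht.2)
  rw [h.eq_add_integral t ht, h.eq_add_integral s hs,
    ← intervalIntegral.integral_interval_sub_left ht' hs']
  ring

theorem mono (h : IsPrimitive a b U g) (hac : a ≤ c) (hcd : c ≤ d) (hdb : d ≤ b) :
    IsPrimitive c d U g where
  memLp := h.memLp.mono_measure (Measure.restrict_mono (Ioo_subset_Ioo hac hdb) le_rfl)
  eq_add_integral t ht := by
    rw [← h.sub_eq_integral (hac.trans (hcd.trans hdb)) ⟨hac, hcd.trans hdb⟩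
      ⟨hac.trans ht.1, ht.2.trans hdb⟩]
    ring

/-- The chain rule for absolutely continuous functions, in integrated form. -/
theorem integral_comp_mul (h : IsPrimitive a b U g) (hab : a ≤ b) {φ : ℝ → ℝ} (hφ : Continuous φ)
    {K : ℝ} (hK : ∀ x, |φ x| ≤ K) :
    ∫ t in a..b, φ (U t) * g t = ∫ x in U a..U b, φ x := by
  set V : ℝ → ℝ := fun t => U a + ∫ s in a..t, g s with hV
  set Φ : ℝ → ℝ := fun y => ∫ x in U a..y, φ x with hΦ
  have hder (y : ℝ) : HasDerivAt Φ (φ y) y :=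
    intervalIntegral.integral_hasDerivAt_right (hφ.intervalIntegrable _ _)
      (hφ.stronglyMeasurableAtFilter _ _) hφ.continuousAt
  have hlip (x y : ℝ) : dist (Φ x) (Φ y) ≤ K * dist x y := by
    have := Convex.norm_image_sub_le_of_norm_hasDerivWithin_le (s := univ)
      (fun z _ => (hder z).hasDerivWithinAt) (fun z _ => hK z) convex_univ (mem_univ y) (mem_univ x)
    rwa [dist_eq_norm, dist_eq_norm]
  have hac : AbsolutelyContinuousOnInterval (fun t => Φ (V t)) a b := by
    have h0 := (h.absolutelyContinuous hab)
    unfold AbsolutelyContinuousOnInterval at h0 ⊢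
    refine squeeze_zero (fun E => Finset.sum_nonneg fun _ _ => dist_nonneg) (fun E => ?_)
      (by simpa only [mul_zero] using h0.const_mul K)
    rw [Finset.mul_sum]
    exact Finset.sum_le_sum fun i _ => hlip _ _
  have hVU (t : ℝ) (ht : t ∈ Icc a b) : V t = U t := (h.eq_add_integral t ht).symm
  have h1 := hac.integral_deriv_eq_sub
  rw [hVU a (left_mem_Icc.mpr hab), hVU b (right_mem_Icc.mpr hab)] at h1
  have h2 : ∫ t in a..b, φ (U t) * g t = ∫ t in a..b, deriv (fun t => Φ (V t)) t := by
    refine intervalIntegral.integral_congr_ae ?_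
    filter_upwards [h.ae_hasDerivAt hab] with t ht htm
    rw [uIoc_of_le hab] at htm
    have htm' := Ioc_subset_Icc_self htm
    have hd : HasDerivAt (fun t => Φ (V t)) (φ (V t) * g t) t := (hder (V t)).comp t (ht htm')
    rw [hd.deriv, hVU t htm']
  rw [h2, h1, hΦ]
  simp

/-- Integration by parts against a test function. -/
theorem integral_mul_deriv (h : IsPrimitive a b U g) (hab : a < b) {φ : ℝ → ℝ}
    (hφ : IsTestFunction a b φ) :
    ∫ t in Ioo a b, U t * deriv φ t = -∫ t in Ioo a b, g t * φ t := by
  have hφac : AbsolutelyContinuousOnInterval φ a b :=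
    (hφ.smooth.of_le (by simp)).contDiffOn.absolutelyContinuousOnInterval
  have h1 := (h.absolutelyContinuous hab.le).integral_mul_deriv_eq_deriv_mul hφac
  have ha : φ a = 0 := image_eq_zero_of_notMem_tsupport fun h => (hφ.support_subset h).1.false
  have hb : φ b = 0 := image_eq_zero_of_notMem_tsupport fun h => (hφ.support_subset h).2.false
  rw [ha, hb, mul_zero, mul_zero, sub_zero, zero_sub] at h1
  rw [← integral_Ioc_eq_integral_Ioo, ← integral_Ioc_eq_integral_Ioo,
    ← intervalIntegral.integral_of_le hab.le, ← intervalIntegral.integral_of_le hab.le]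
  calc _ = ∫ t in a..b, (U a + ∫ s in a..t, g s) * deriv φ t := by
        refine intervalIntegral.integral_congr fun t ht => ?_
        rw [uIcc_of_le hab.le] at ht
        simp only [h.eq_add_integral t ht]
    _ = _ := by
        rw [h1]
        congr 1
        refine intervalIntegral.integral_congr_ae ?_
        filter_upwards [h.ae_hasDerivAt hab.le] with t ht htm
        rw [uIoc_of_le hab.le] at htm
        rw [(ht (Ioc_subset_Icc_self htm)).deriv]

theorem memLp_self (h : IsPrimitive a b U g) (hab : a ≤ b) :
    MemLp U 2 (volume.restrict (Ioo a b)) := by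
  have hc := h.continuousOn hab
  obtain ⟨C, hC⟩ := isCompact_Icc.exists_bound_of_continuousOn hc
  refine MemLp.of_bound ((hc.mono Ioo_subset_Icc_self).aestronglyMeasurable measurableSet_Ioo) C ?_
  rw [ae_restrict_iff' measurableSet_Ioo]
  exact ae_of_all _ fun t ht => hC t (Ioo_subset_Icc_self ht)

/-- An absolutely continuous function with derivative in `L²` defines an element of `H¹`. -/
theorem exists_h1 (h : IsPrimitive a b U g) (hab : a < b) :
    ∃ u : H1Interval a b, h1Val u =ᵐ[volume.restrict (Ioo a b)] U ∧
      h1Deriv u =ᵐ[volume.restrict (Ioo a b)] g := by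
  have hU := h.memLp_self hab.le
  refine ⟨⟨WithLp.toLp 2 (hU.toLp U, h.memLp.toLp g), fun φ hφ => ?_⟩,
    hU.coeFn_toLp, h.memLp.coeFn_toLp⟩
  have h1 : ∫ t in Ioo a b, (hU.toLp U) t * deriv φ t = ∫ t in Ioo a b, U t * deriv φ t :=
    integral_congr_ae (hU.coeFn_toLp.mono fun t ht => by simp only [ht])
  have h2 : ∫ t in Ioo a b, (h.memLp.toLp g) t * φ t = ∫ t in Ioo a b, g t * φ t :=
    integral_congr_ae (h.memLp.coeFn_toLp.mono fun t ht => by simp only [ht])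
  exact h1.trans ((h.integral_mul_deriv hab hφ).trans (congrArg Neg.neg h2.symm))

theorem congr {U' g' : ℝ → ℝ} (h : IsPrimitive a b U g) (hU : EqOn U' U (Icc a b))
    (hg : ∀ t ∈ Ioo a b, g' t = g t) : IsPrimitive a b U' g' where
  memLp := (memLp_congr_ae ((ae_restrict_iff' measurableSet_Ioo).mpr (ae_of_all _ hg))).mpr h.memLp
  eq_add_integral t ht := by
    rw [hU ht, hU (left_mem_Icc.mpr (ht.1.trans ht.2)), h.eq_add_integral t ht]
    congr 1
    rw [intervalIntegral.integral_of_le ht.1, intervalIntegral.integral_of_le ht.1,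
      integral_Ioc_eq_integral_Ioo, integral_Ioc_eq_integral_Ioo]
    exact setIntegral_congr_fun measurableSet_Ioo fun s hs => (hg s ⟨hs.1, hs.2.trans_le ht.2⟩).symm

/-- Concatenation of two absolutely continuous functions. -/
theorem glue {P q : ℝ → ℝ} (h : IsPrimitive a c U g) (h' : IsPrimitive c b P q) (hac : a ≤ c)
    (hc : U c = P c) :
    IsPrimitive a b (fun t => if t ≤ c then U t else P t) (fun t => if t ≤ c then g t else q t) := by
  have h1 : IsPrimitive a c (fun t => if t ≤ c then U t else P t)
      (fun t => if t ≤ c then g t else q t) :=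
    h.congr (fun t ht => if_pos ht.2) (fun t ht => if_pos ht.2.le)
  have h2 : IsPrimitive c b (fun t => if t ≤ c then U t else P t)
      (fun t => if t ≤ c then g t else q t) := by
    refine h'.congr (fun t ht => ?_) (fun t ht => if_neg (not_le.mpr ht.1))
    rcases ht.1.eq_or_lt with rfl | hlt
    · simp [hc]
    · exact if_neg (not_le.mpr hlt)
  refine ⟨?_, fun t ht => ?_⟩
  · have hp := MemLp.piecewise (μ := volume.restrict (Ioo a b)) (f := g) (g := q) (p := 2)
      (measurableSet_Iic (a := c)) ?_ ?_
    · exact hp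
    · have hle : volume.restrict (Iic c ∩ Ioo a b) ≤ volume.restrict (Ioc a c) :=
        Measure.restrict_mono (fun t ht => mem_Ioc.mpr ⟨ht.2.1, ht.1⟩) le_rfl
      rw [Measure.restrict_restrict measurableSet_Iic]
      rw [← restrict_Ioo_eq_restrict_Ioc] at hle
      exact h.memLp.mono_measure hle
    · rw [Measure.restrict_restrict measurableSet_Iic.compl]
      exact h'.memLp.mono_measure
        (Measure.restrict_mono (fun t ht => mem_Ioo.mpr ⟨not_le.mp ht.1, ht.2.2⟩) le_rfl)
  · rcases le_or_gt t c with htc | htc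
    · exact h1.eq_add_integral t ⟨ht.1, htc⟩
    · rw [h2.eq_add_integral t ⟨htc.le, ht.2⟩, h1.eq_add_integral c ⟨hac, le_rfl⟩, add_assoc,
        intervalIntegral.integral_add_adjacent_intervals (h1.intervalIntegrable hac)
        ((h2.mono le_rfl htc.le ht.2).intervalIntegrable htc.le)]

theorem of_hasDerivAt (hU : ContinuousOn U (Icc a b)) (hg : ContinuousOn g (Icc a b))
    (h : ∀ t ∈ Ioo a b, HasDerivAt U (g t) t) : IsPrimitive a b U g where
  memLp := by
    obtain ⟨C, hC⟩ := isCompact_Icc.exists_bound_of_continuousOn hg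
    refine MemLp.of_bound ((hg.mono Ioo_subset_Icc_self).aestronglyMeasurable measurableSet_Ioo) C ?_
    rw [ae_restrict_iff' measurableSet_Ioo]
    exact ae_of_all _ fun t ht => hC t (Ioo_subset_Icc_self ht)
  eq_add_integral t ht := by
    have hs : Icc a t ⊆ Icc a b := Icc_subset_Icc_right ht.2
    rw [intervalIntegral.integral_eq_sub_of_hasDerivAt_of_le ht.1 (hU.mono hs)
      (fun s hs => h s ⟨hs.1, hs.2.trans_le ht.2⟩)]
    · ring
    · exact (hg.mono (by rw [uIcc_of_le ht.1]; exact hs)).intervalIntegrable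

/-- Time reversal. -/
theorem reverse (h : IsPrimitive a b U g) (hab : a ≤ b) :
    IsPrimitive a b (fun t => U (a + b - t)) (fun t => -g (a + b - t)) where
  memLp := by
    have hp : MeasurePreserving (fun t : ℝ => a + b - t) (volume.restrict (Ioo a b))
        (volume.restrict (Ioo a b)) := by
      have := (Measure.measurePreserving_sub_left (volume : Measure ℝ) (a + b)).restrict_preimage
        (measurableSet_Ioo (a := a) (b := b))
      have he : (fun t : ℝ => a + b - t) ⁻¹' Ioo a b = Ioo a b := by
        ext t
        simp only [mem_preimage, mem_Ioo]
        constructor <;> rintro ⟨h1, h2⟩ <;> constructor <;> linarith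
      rwa [he] at this
    exact (h.memLp.comp_measurePreserving hp).neg
  eq_add_integral t ht := by
    have hs := h.sub_eq_integral hab (s := a + b - t) (t := b)
      ⟨by linarith [ht.2], by linarith [ht.1]⟩ ⟨hab, le_rfl⟩
    rw [intervalIntegral.integral_neg, intervalIntegral.integral_comp_sub_left (fun s => g s)]
    rw [add_sub_cancel_left, ← hs]
    ring

end IsPrimitive

/-- Every element of `H¹` has an absolutely continuous representative. -/
theorem H1Interval.exists_isPrimitive {a b : ℝ} (hab : a < b) (u : H1Interval a b) :
    ∃ U, IsPrimitive a b U (h1Deriv u) ∧ h1Val u =ᵐ[volume.restrict (Ioo a b)] U := by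
  have h : IsPrimitive a b (fun t => ∫ s in a..t, h1Deriv u s) (h1Deriv u) :=
    ⟨Lp.memLp _, fun t _ => by simp⟩
  have hm := h.memLp_self hab.le
  have hu : MemLp (h1Val u) 2 (volume.restrict (Ioo a b)) := Lp.memLp _
  obtain ⟨c, hc⟩ := exists_ae_eq_const_of_integral_mul_deriv_eq_zero hab
    (w := fun t => h1Val u t - ∫ s in a..t, h1Deriv u s)
    ((hu.sub hm).integrable (by norm_num)) fun φ hφ => by
      have hd : MemLp (deriv φ) 2 (volume.restrict (Ioo a b)) :=
        hφ.continuous_deriv.memLp_of_hasCompactSupport hφ.compact.deriv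
      have h1 : ∫ t in Ioo a b, h1Val u t * deriv φ t = -∫ t in Ioo a b, h1Deriv u t * φ t :=
        u.2 φ hφ
      have h2 := h.integral_mul_deriv hab hφ
      simp_rw [sub_mul]
      rw [integral_sub, h1, h2, sub_self]
      · exact hu.integrable_mul hd
      · exact hm.integrable_mul hd
  refine ⟨fun t => c + ∫ s in a..t, h1Deriv u s, ⟨Lp.memLp _, fun t _ => by simp⟩, ?_⟩
  filter_upwards [hc] with t ht
  linarith

/-! ### Energies of paths and the calibration inequality -/

/-- The energy `∫ₐᵇ (g² + V(U)) dt` of a path `U` with derivative `g`. -/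
def pathEnergy (V : ℝ → ℝ) (a b : ℝ) (U g : ℝ → ℝ) : ℝ := ∫ t in a..b, (g t ^ 2 + V (U t))

/-- `c(lam) = 2 ∫₀¹ √(V - lam)`, the cost of crossing one period of `V` at the level `lam`, in
excess of `lam` times the duration. -/
def crossingCost (V : ℝ → ℝ) (lam : ℝ) : ℝ := 2 * ∫ x in (0 : ℝ)..1, √(V x - lam)

theorem crossingCost_nonneg (V : ℝ → ℝ) (lam : ℝ) : 0 ≤ crossingCost V lam :=
  mul_nonneg zero_le_two (intervalIntegral.integral_nonneg zero_le_one fun _ _ => Real.sqrt_nonneg _)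

section PathEnergy

variable {V U g P q : ℝ → ℝ} {a b c lam : ℝ}

theorem IsPrimitive.intervalIntegrable_energy (h : IsPrimitive a b U g) (hab : a ≤ b)
    (hV : Continuous V) : IntervalIntegrable (fun t => g t ^ 2 + V (U t)) volume a b := by
  refine (h.intervalIntegrable_sq hab).add (ContinuousOn.intervalIntegrable ?_)
  rw [uIcc_of_le hab]
  exact hV.comp_continuousOn (h.continuousOn hab)

/-- The calibration inequality: `g² + V(U) ≥ lam + 2 |g| √(V(U) - lam)`, and the integral of the
last term is bounded below by a quantity that depends on the end points of the path only. -/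
theorem IsPrimitive.le_pathEnergy (h : IsPrimitive a b U g) (hab : a ≤ b) (hV : Continuous V)
    {M : ℝ} (hM : ∀ x, V x ≤ M) (hlam : ∀ x, lam ≤ V x) :
    lam * (b - a) + 2 * |∫ x in U a..U b, √(V x - lam)| ≤ pathEnergy V a b U g := by
  have hφ : Continuous fun x => √(V x - lam) := (hV.sub continuous_const).sqrt
  have hb (x : ℝ) : |√(V x - lam)| ≤ √(M - lam) := by
    rw [abs_of_nonneg (Real.sqrt_nonneg _)]
    exact Real.sqrt_le_sqrt (by linarith [hM x])
  have hi : IntervalIntegrable (fun t => √(V (U t) - lam) * g t) volume a b := by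
    refine (h.intervalIntegrable hab).continuousOn_mul ?_
    rw [uIcc_of_le hab]
    exact hφ.comp_continuousOn (h.continuousOn hab)
  rw [← h.integral_comp_mul hab hφ hb]
  have h1 := intervalIntegral.abs_integral_le_integral_abs (μ := volume)
    (f := fun t => √(V (U t) - lam) * g t) hab
  have h2 : ∫ t in a..b, (lam + 2 * |√(V (U t) - lam) * g t|) ≤ pathEnergy V a b U g := by
    refine intervalIntegral.integral_mono_on hab
      ((intervalIntegrable_const).add (hi.abs.const_mul 2)) (h.intervalIntegrable_energy hab hV)
      fun t _ => ?_
    have hs := Real.sq_sqrt (sub_nonneg.mpr (hlam (U t)))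
    rw [abs_mul, abs_of_nonneg (Real.sqrt_nonneg _)]
    nlinarith [sq_nonneg (√(V (U t) - lam) - |g t|), sq_abs (g t)]
  rw [intervalIntegral.integral_add intervalIntegrable_const (hi.abs.const_mul 2),
    intervalIntegral.integral_const, intervalIntegral.integral_const_mul, smul_eq_mul] at h2
  linarith

/-- Solutions of `U' = √(V(U) - lam)` are calibrated. -/
theorem IsPrimitive.pathEnergy_eq (h : IsPrimitive a b U g) (hab : a ≤ b) (hV : Continuous V)
    {M : ℝ} (hM : ∀ x, V x ≤ M) (hlam : ∀ x, lam ≤ V x)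
    (hg : ∀ t ∈ Icc a b, g t = √(V (U t) - lam)) :
    pathEnergy V a b U g = lam * (b - a) + 2 * ∫ x in U a..U b, √(V x - lam) := by
  have hφ : Continuous fun x => √(V x - lam) := (hV.sub continuous_const).sqrt
  have hb (x : ℝ) : |√(V x - lam)| ≤ √(M - lam) := by
    rw [abs_of_nonneg (Real.sqrt_nonneg _)]
    exact Real.sqrt_le_sqrt (by linarith [hM x])
  have hi : IntervalIntegrable (fun t => √(V (U t) - lam) * g t) volume a b := by
    refine (h.intervalIntegrable hab).continuousOn_mul ?_
    rw [uIcc_of_le hab]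
    exact hφ.comp_continuousOn (h.continuousOn hab)
  rw [← h.integral_comp_mul hab hφ hb]
  have h2 : pathEnergy V a b U g = ∫ t in a..b, (lam + 2 * (√(V (U t) - lam) * g t)) := by
    refine intervalIntegral.integral_congr fun t ht => ?_
    rw [uIcc_of_le hab] at ht
    have hs := Real.sq_sqrt (sub_nonneg.mpr (hlam (U t)))
    simp only [hg t ht]
    linarith
  rw [h2, intervalIntegral.integral_add intervalIntegrable_const (hi.const_mul 2),
    intervalIntegral.integral_const, intervalIntegral.integral_const_mul, smul_eq_mul]
  ring

theorem pathEnergy_add (h : IsPrimitive a b U g) (hac : a ≤ c) (hcb : c ≤ b) (hV : Continuous V) :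
    pathEnergy V a c U g + pathEnergy V c b U g = pathEnergy V a b U g :=
  intervalIntegral.integral_add_adjacent_intervals
    ((h.mono le_rfl hac hcb).intervalIntegrable_energy hac hV)
    ((h.mono hac hcb le_rfl).intervalIntegrable_energy hcb hV)

theorem pathEnergy_congr (hab : a ≤ b) (hU : ∀ t ∈ Ioo a b, P t = U t)
    (hg : ∀ t ∈ Ioo a b, q t = g t) :
    pathEnergy V a b P q = pathEnergy V a b U g := by
  unfold pathEnergy
  rw [intervalIntegral.integral_of_le hab, intervalIntegral.integral_of_le hab,
    integral_Ioc_eq_integral_Ioo, integral_Ioc_eq_integral_Ioo]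
  exact setIntegral_congr_fun measurableSet_Ioo fun t ht => by simp only [hU t ht, hg t ht]

theorem pathEnergy_glue (h : IsPrimitive a c U g) (h' : IsPrimitive c b P q) (hac : a ≤ c)
    (hcb : c ≤ b) (hc : U c = P c) (hV : Continuous V) :
    pathEnergy V a b (fun t => if t ≤ c then U t else P t) (fun t => if t ≤ c then g t else q t) =
      pathEnergy V a c U g + pathEnergy V c b P q := by
  rw [← pathEnergy_add (h.glue h' hac hc) hac hcb hV]
  congr 1
  · exact pathEnergy_congr hac (fun t ht => if_pos ht.2.le) (fun t ht => if_pos ht.2.le)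
  · exact pathEnergy_congr hcb (fun t ht => if_neg (not_le.mpr ht.1))
      (fun t ht => if_neg (not_le.mpr ht.1))

theorem pathEnergy_reverse :
    pathEnergy V a b (fun t => U (a + b - t)) (fun t => -g (a + b - t)) = pathEnergy V a b U g := by
  unfold pathEnergy
  simp only [neg_sq]
  rw [intervalIntegral.integral_comp_sub_left (fun t => g t ^ 2 + V (U t)), add_sub_cancel_right,
    add_sub_cancel_left]

theorem pathEnergy_const (x : ℝ) : pathEnergy V a b (fun _ => x) (fun _ => 0) = V x * (b - a) := by
  simp [pathEnergy, mul_comm]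

theorem IsPrimitive.const (a b x : ℝ) : IsPrimitive a b (fun _ => x) (fun _ => 0) :=
  ⟨MemLp.zero', fun t _ => by simp⟩

theorem lintegral_Ioo_glue_le (F : ℝ → ℝ≥0∞) :
    ∫⁻ t in Ioo a b, F (if t ≤ c then U t else P t) ≤
      (∫⁻ t in Ioo a c, F (U t)) + ∫⁻ t in Ioo c b, F (P t) := by
  have h1 : ∫⁻ t in Ioc a c, F (if t ≤ c then U t else P t) = ∫⁻ t in Ioo a c, F (U t) := by
    rw [restrict_Ioo_eq_restrict_Ioc]
    exact setLIntegral_congr_fun measurableSet_Ioc fun t ht => by simp only [if_pos ht.2]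
  have h2 : ∫⁻ t in Ioo c b, F (if t ≤ c then U t else P t) = ∫⁻ t in Ioo c b, F (P t) :=
    setLIntegral_congr_fun measurableSet_Ioo fun t ht => by simp only [if_neg (not_le.mpr ht.1)]
  rw [← h1, ← h2]
  refine (lintegral_mono_set fun t ht => ?_).trans (lintegral_union_le _ _ _)
  rcases le_or_gt t c with htc | htc
  · exact Or.inl ⟨ht.1, htc⟩
  · exact Or.inr ⟨htc, ht.2⟩

theorem lintegral_Ioo_reverse (F : ℝ → ℝ≥0∞) :
    ∫⁻ t in Ioo a b, F (U (a + b - t)) = ∫⁻ t in Ioo a b, F (U t) := by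
  have := (Measure.measurePreserving_sub_left (volume : Measure ℝ) (a + b)).setLIntegral_comp_preimage_emb
    (Homeomorph.subLeft (a + b)).measurableEmbedding (fun t => F (U t)) (Ioo a b)
  have he : (fun t : ℝ => a + b - t) ⁻¹' Ioo a b = Ioo a b := by
    ext t
    simp only [mem_preimage, mem_Ioo]
    constructor <;> rintro ⟨h1, h2⟩ <;> constructor <;> linarith
  rwa [he] at this

end PathEnergy

section Periodic

variable {ψ : ℝ → ℝ} {a b : ℝ}

/-- Rounding the length of the interval down and up to integers leaves an error of at most one
period. -/
theorem Function.Periodic.abs_integral_sub_le (hψ : Continuous ψ) (hper : Function.Periodic ψ 1)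
    (h0 : ∀ x, 0 ≤ ψ x) (hab : a ≤ b) :
    |(∫ x in a..b, ψ x) - (b - a) * ∫ x in (0 : ℝ)..1, ψ x| ≤ ∫ x in (0 : ℝ)..1, ψ x := by
  have hA : 0 ≤ ∫ x in (0 : ℝ)..1, ψ x :=
    intervalIntegral.integral_nonneg zero_le_one fun x _ => h0 x
  have hint (s t : ℝ) : IntervalIntegrable ψ volume s t := hψ.intervalIntegrable s t
  have hn (n : ℕ) : ∫ x in a..a + n, ψ x = n * ∫ x in (0 : ℝ)..1, ψ x := by
    have := hper.intervalIntegral_add_zsmul_eq n a fun s t => hint s t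
    have h1 := hper.intervalIntegral_add_eq a 0
    rw [zero_add] at h1
    simpa [h1] using this
  have h1 : ∫ x in a..b, ψ x ≤ ∫ x in a..a + ⌈b - a⌉₊, ψ x :=
    intervalIntegral.integral_mono_interval le_rfl hab (by linarith [Nat.le_ceil (b - a)])
      (ae_of_all _ h0) (hint _ _)
  have h2 : ∫ x in a..a + ⌊b - a⌋₊, ψ x ≤ ∫ x in a..b, ψ x :=
    intervalIntegral.integral_mono_interval le_rfl (by simp)
      (by linarith [Nat.floor_le (sub_nonneg.mpr hab)]) (ae_of_all _ h0) (hint _ _)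
  rw [hn] at h1 h2
  have h3 := (Nat.ceil_lt_add_one (sub_nonneg.mpr hab)).le
  have h4 := (Nat.lt_floor_add_one (b - a)).le
  rw [abs_le]
  constructor <;> nlinarith

/-- The integral of a rapidly oscillating periodic function is its mean times the length, up to an
error of order `ε`. -/
theorem Function.Periodic.abs_integral_div_sub_le (hψ : Continuous ψ)
    (hper : Function.Periodic ψ 1) (h0 : ∀ x, 0 ≤ ψ x) {ε : ℝ} (hε : 0 < ε) (a b : ℝ) :
    abs (|∫ x in a..b, ψ (x / ε)| - |b - a| * ∫ x in (0 : ℝ)..1, ψ x) ≤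
      ε * ∫ x in (0 : ℝ)..1, ψ x := by
  wlog hab : a ≤ b generalizing a b
  · rw [intervalIntegral.integral_symm, abs_neg, abs_sub_comm b a]
    exact this b a (le_of_not_ge hab)
  have hd : a / ε ≤ b / ε := div_le_div_of_nonneg_right hab hε.le
  rw [abs_of_nonneg (intervalIntegral.integral_nonneg hab fun x _ => h0 _),
    abs_of_nonneg (sub_nonneg.mpr hab), intervalIntegral.integral_comp_div ψ hε.ne', smul_eq_mul]
  have h1 := hper.abs_integral_sub_le hψ h0 hd
  have h2 : ε * (∫ x in a / ε..b / ε, ψ x) - (b - a) * ∫ x in (0 : ℝ)..1, ψ x =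
      ε * ((∫ x in a / ε..b / ε, ψ x) - (b / ε - a / ε) * ∫ x in (0 : ℝ)..1, ψ x) := by
    field_simp
  rw [h2, abs_mul, abs_of_pos hε]
  exact mul_le_mul_of_nonneg_left h1 hε.le

/-- The cost of travelling from `a` to `b` in the potential `V(·/ε)` is `c(lam) |b - a|`, up to an
error of order `ε`. -/
theorem abs_crossing_sub_le {V : ℝ → ℝ} (hV : Continuous V) (hper : Function.Periodic V 1)
    (lam : ℝ) {ε : ℝ} (hε : 0 < ε) (a b : ℝ) :
    abs (2 * |∫ x in a..b, √(V (x / ε) - lam)| - crossingCost V lam * |b - a|) ≤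
      ε * crossingCost V lam := by
  have h := Function.Periodic.abs_integral_div_sub_le (ψ := fun x => √(V x - lam))
    (hV.sub continuous_const).sqrt (fun x => by simp only [hper x]) (fun _ => Real.sqrt_nonneg _)
    hε a b
  unfold crossingCost
  rw [abs_le] at h ⊢
  constructor <;> nlinarith [h.1, h.2]

theorem crossingCost_le {V : ℝ → ℝ} (hV : Continuous V) {M : ℝ} (hM : ∀ x, V x ≤ M) (lam : ℝ) :
    crossingCost V lam ≤ 2 * √(M - lam) := by
  have h1 : ∫ x in (0 : ℝ)..1, √(V x - lam) ≤ ∫ _ in (0 : ℝ)..1, √(M - lam) :=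
    intervalIntegral.integral_mono_on zero_le_one
      ((hV.sub continuous_const).sqrt.intervalIntegrable _ _) intervalIntegrable_const
      fun x _ => Real.sqrt_le_sqrt (by linarith [hM x])
  simp only [intervalIntegral.integral_const, sub_zero, one_smul] at h1
  unfold crossingCost
  linarith

end Periodic

/-! ### Travelling at a prescribed speed -/

/-- The autonomous equation `w' = φ(w)` for a continuous speed `φ ≥ 0` whose reciprocal is
integrable on `[x,y]`: there is a solution that travels from `x` to `y` in the time `∫ₓʸ 1/φ`. It is
the inverse of the travel time `s ↦ ∫ₓˢ 1/φ`, and it is differentiable at the zeros of `φ`, too. -/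
theorem exists_travel {φ : ℝ → ℝ} (hφ : Continuous φ) (h0 : ∀ s, 0 ≤ φ s) {x y : ℝ} (hxy : x ≤ y)
    (hne : ∀ᵐ s, s ∈ Icc x y → φ s ≠ 0)
    (hint : IntervalIntegrable (fun s => (φ s)⁻¹) volume x y) (a : ℝ) :
    ∃ w : ℝ → ℝ, w a = x ∧ w (a + ∫ s in x..y, (φ s)⁻¹) = y ∧ Continuous w ∧ StrictMono w ∧
      ∀ t ∈ Ioo a (a + ∫ s in x..y, (φ s)⁻¹), HasDerivAt w (φ (w t)) t := by
  classical
  set S : Set ℝ := Icc x y ∩ {s | φ s ≠ 0} with hS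
  have hSm : MeasurableSet S :=
    measurableSet_Icc.inter (hφ.measurable (measurableSet_singleton 0).compl)
  -- the travel time per unit of length, continued by `1` so that the travel time is a bijection
  set k : ℝ → ℝ := fun s => if s ∈ S then (φ s)⁻¹ else 1 with hk
  have hkae : ∀ᵐ s, s ∈ Icc x y → k s = (φ s)⁻¹ ∧ φ s ≠ 0 := by
    filter_upwards [hne] with s hs hm
    exact ⟨if_pos ⟨hm, hs hm⟩, hs hm⟩
  have hki (p q : ℝ) : IntervalIntegrable k volume p q := by
    have hdec : k = S.indicator (fun s => (φ s)⁻¹) + Sᶜ.indicator (fun _ => 1) := by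
      funext s
      by_cases hs : s ∈ S <;> simp [hk, hs]
    rw [hdec]
    refine IntervalIntegrable.add ?_ ?_
    · refine Integrable.intervalIntegrable ?_
      rw [integrable_indicator_iff hSm]
      exact ((intervalIntegrable_iff_integrableOn_Icc_of_le hxy).mp hint).mono_set inter_subset_left
    · exact ⟨(integrableOn_const (by simp)).indicator hSm.compl,
        (integrableOn_const (by simp)).indicator hSm.compl⟩
  obtain ⟨M, hM⟩ := isCompact_Icc.exists_bound_of_continuousOn (s := Icc x y) hφ.continuousOn
  set κ : ℝ := min (max M 1)⁻¹ 1 with hκ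
  have hκ0 : 0 < κ := lt_min (inv_pos.mpr (lt_max_of_lt_right one_pos)) one_pos
  have hkκ (s : ℝ) : κ ≤ k s := by
    by_cases hs : s ∈ S
    · rw [hk]
      simp only [if_pos hs]
      refine (min_le_left _ _).trans ?_
      have h1 : 0 < φ s := (h0 s).lt_of_ne' hs.2
      exact inv_anti₀ h1 ((le_abs_self _).trans ((hM s hs.1).trans (le_max_left _ _)))
    · rw [hk]
      simp only [if_neg hs]
      exact min_le_right _ _
  set τ : ℝ → ℝ := fun s => ∫ r in x..s, k r with hτ
  have hτsub (p q : ℝ) : τ q - τ p = ∫ r in p..q, k r :=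
    intervalIntegral.integral_interval_sub_left (hki x q) (hki x p)
  have hτκ {p q : ℝ} (hpq : p ≤ q) : κ * (q - p) ≤ τ q - τ p := by
    rw [hτsub]
    have := intervalIntegral.integral_mono_on hpq (intervalIntegrable_const (c := κ))
      (hki p q) fun s _ => hkκ s
    rw [intervalIntegral.integral_const, smul_eq_mul] at this
    linarith
  have hτx : τ x = 0 := intervalIntegral.integral_same
  have hτy : τ y = ∫ s in x..y, (φ s)⁻¹ := by
    refine intervalIntegral.integral_congr_ae ?_
    filter_upwards [hkae] with s hs hm
    rw [uIoc_of_le hxy] at hm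
    exact (hs (Ioc_subset_Icc_self hm)).1
  have hmono : StrictMono τ := fun p q hpq => by
    have := hτκ hpq.le
    have := mul_pos hκ0 (sub_pos.mpr hpq)
    linarith
  have hcont : Continuous τ := intervalIntegral.continuous_primitive hki x
  have hsurj : Function.Surjective τ := by
    refine hcont.surjective ?_ ?_
    · refine tendsto_atTop_mono' _ ?_
        ((tendsto_atTop_add_const_right atTop (-x) tendsto_id).const_mul_atTop hκ0)
      filter_upwards [eventually_ge_atTop x] with s hs
      have := hτκ hs
      simp only [id]
      linarith
    · refine tendsto_atBot_mono' _ ?_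
        ((tendsto_atBot_add_const_right atBot (-x) tendsto_id).const_mul_atBot hκ0)
      filter_upwards [eventually_le_atBot x] with s hs
      have := hτκ hs
      simp only [id]
      linarith
  set e := hmono.orderIsoOfSurjective τ hsurj with he
  have heτ (s : ℝ) : e.symm (τ s) = s := e.symm_apply_apply s
  have hτe (r : ℝ) : τ (e.symm r) = r := e.apply_symm_apply r
  refine ⟨fun t => e.symm (t - a), ?_, ?_, e.symm.continuous.comp (continuous_sub_right a),
    e.symm.strictMono.comp fun _ _ h => sub_lt_sub_right h a, fun t ht => ?_⟩
  · simp only [sub_self]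
    rw [← hτx, heτ]
  · simp only [add_sub_cancel_left]
    rw [← hτy, heτ]
  · set r₀ := t - a with hr₀
    set s₀ := e.symm r₀ with hs₀
    have hs₀m : s₀ ∈ Ioo x y := by
      rw [← heτ x, ← heτ y, hτx, hτy]
      exact ⟨e.symm.strictMono (by rw [hr₀]; linarith [ht.1]),
        e.symm.strictMono (by rw [hr₀]; linarith [ht.2])⟩
    have key : HasDerivAt (fun r => e.symm r) (φ s₀) r₀ := by
      rw [hasDerivAt_iff_isLittleO, Asymptotics.isLittleO_iff]
      intro δ hδ
      have h1 : ∀ᶠ s in 𝓝 s₀, s ∈ Ioo x y ∧ |φ s - φ s₀| < δ :=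
        Filter.Eventually.and (Ioo_mem_nhds hs₀m.1 hs₀m.2)
          (Metric.continuousAt_iff'.mp hφ.continuousAt δ hδ)
      obtain ⟨ρ, hρ, hball⟩ := Metric.eventually_nhds_iff_ball.mp h1
      have h2 : ∀ᶠ r in 𝓝 r₀, e.symm r ∈ Metric.ball s₀ ρ :=
        e.symm.continuous.continuousAt.eventually (Metric.ball_mem_nhds _ hρ)
      filter_upwards [h2] with r hr
      set s := e.symm r with hs
      have hrs : r - r₀ = ∫ q in s₀..s, k q := by rw [← hτsub, hτe, hτe]
      have hsub : ∀ q ∈ uIoc s₀ s, q ∈ Metric.ball s₀ ρ := fun q hq => by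
        have hc := (convex_ball s₀ ρ).ordConnected
        exact hc.uIcc_subset (Metric.mem_ball_self hρ) hr (uIoc_subset_uIcc hq)
      -- since `φ k = 1`, the error is an integral of `(φ - φ(s₀)) k`
      have hid : s - s₀ - (r - r₀) • φ s₀ = ∫ q in s₀..s, (φ q - φ s₀) * k q := by
        have h3 : ∫ q in s₀..s, φ q * k q = s - s₀ := by
          rw [← mul_one (s - s₀), ← smul_eq_mul, ← intervalIntegral.integral_const]
          refine intervalIntegral.integral_congr_ae ?_
          filter_upwards [hkae] with q hq hm
          have := hq (Ioo_subset_Icc_self (hball q (hsub q hm)).1)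
          rw [this.1, mul_inv_cancel₀ this.2]
        rw [hrs, ← h3, smul_eq_mul, mul_comm (∫ q in s₀..s, k q),
          ← intervalIntegral.integral_const_mul, ← intervalIntegral.integral_sub
            ((hki _ _).continuousOn_mul hφ.continuousOn) ((hki _ _).const_mul _)]
        exact intervalIntegral.integral_congr fun q _ => by ring
      rw [hid, hrs]
      refine (intervalIntegral.norm_integral_le_abs_of_norm_le (g := fun q => δ * k q) ?_
        ((hki _ _).const_mul δ)).trans (le_of_eq ?_)
      · refine (ae_restrict_iff' measurableSet_uIoc).mpr (ae_of_all _ fun q hq => ?_)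
        rw [norm_mul, Real.norm_eq_abs, Real.norm_eq_abs, abs_of_pos (hκ0.trans_le (hkκ q))]
        exact mul_le_mul_of_nonneg_right (hball q (hsub q hq)).2.le (hκ0.trans_le (hkκ q)).le
      · rw [intervalIntegral.integral_const_mul, abs_mul, abs_of_pos hδ, Real.norm_eq_abs]
    exact key.comp_sub_const t a

/-! ### Optimal connections of two points -/

section Connection

variable {V : ℝ → ℝ} {m M lam x y : ℝ}

/-- The time that a solution of `U' = √(V(U) - lam)` needs to travel from `x` to `y`. Where `V =
lam`, the integrand takes the junk value `0`; it is used at such levels only if `V ≠ lam` a.e. -/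
def travelTime (V : ℝ → ℝ) (x y lam : ℝ) : ℝ := ∫ s in x..y, (√(V s - lam))⁻¹

theorem travelTime_nonneg (V : ℝ → ℝ) (hxy : x ≤ y) (lam : ℝ) : 0 ≤ travelTime V x y lam :=
  intervalIntegral.integral_nonneg hxy fun _ _ => inv_nonneg.mpr (Real.sqrt_nonneg _)

/-- The calibrated path from `x` to `y` at the level `lam`. Above a minimal speed `η` it spends at
most the time `|A| / η` in a set `A`. -/
theorem exists_calibrated_path (hV : Continuous V) (hM : ∀ s, V s ≤ M) (hlam : ∀ s, lam ≤ V s)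
    (hxy : x ≤ y) (hne : ∀ᵐ s, s ∈ Icc x y → √(V s - lam) ≠ 0)
    (hint : IntervalIntegrable (fun s => (√(V s - lam))⁻¹) volume x y) (a : ℝ) :
    ∃ U g, IsPrimitive a (a + travelTime V x y lam) U g ∧ U a = x ∧
      U (a + travelTime V x y lam) = y ∧
      (∀ t ∈ Icc a (a + travelTime V x y lam), U t ∈ Icc x y) ∧
      (∀ t, g t = √(V (U t) - lam)) ∧
      pathEnergy V a (a + travelTime V x y lam) U g =
        lam * travelTime V x y lam + 2 * ∫ s in x..y, √(V s - lam) ∧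
      ∀ η : ℝ, 0 < η → (∀ s, η ≤ √(V s - lam)) → ∀ F : ℝ → ℝ≥0∞,
        ∫⁻ t in Ioo a (a + travelTime V x y lam), F (U t) ≤
          (ENNReal.ofReal η)⁻¹ * ∫⁻ s in Icc x y, F s := by
  have hφ : Continuous fun s => √(V s - lam) := (hV.sub continuous_const).sqrt
  have hT : a ≤ a + travelTime V x y lam := by linarith [travelTime_nonneg V hxy lam]
  obtain ⟨w, hwa, hwb, hwc, hwm, hwd⟩ := exists_travel hφ (fun _ => Real.sqrt_nonneg _) hxy hne hint a
  change w (a + travelTime V x y lam) = y at hwb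
  change ∀ t ∈ Ioo a (a + travelTime V x y lam), _ at hwd
  have hp : IsPrimitive a (a + travelTime V x y lam) w fun t => √(V (w t) - lam) :=
    IsPrimitive.of_hasDerivAt hwc.continuousOn (hφ.comp hwc).continuousOn hwd
  have hr (t : ℝ) (ht : t ∈ Icc a (a + travelTime V x y lam)) : w t ∈ Icc x y :=
    ⟨hwa ▸ hwm.monotone ht.1, hwb ▸ hwm.monotone ht.2⟩
  refine ⟨w, _, hp, hwa, hwb, hr, fun t => rfl, ?_, fun η hη hηφ F => ?_⟩
  · rw [hp.pathEnergy_eq hT hV hM hlam fun t _ => rfl, hwa, hwb, add_sub_cancel_left]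
  · have h1 := lintegral_image_eq_lintegral_abs_deriv_mul measurableSet_Ioo
      (fun t ht => (hwd t ht).hasDerivWithinAt) hwm.injective.injOn F
    have h2 : w '' Ioo a (a + travelTime V x y lam) ⊆ Icc x y := by
      rintro _ ⟨t, ht, rfl⟩
      exact hr t (Ioo_subset_Icc_self ht)
    have h3 : ENNReal.ofReal η * ∫⁻ t in Ioo a (a + travelTime V x y lam), F (w t) ≤
        ∫⁻ s in Icc x y, F s := by
      rw [← lintegral_const_mul' _ _ ENNReal.ofReal_ne_top]
      refine le_trans ?_ (h1.symm.le.trans (lintegral_mono_set h2))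
      refine lintegral_mono fun t => mul_le_mul_left ?_ _
      exact ENNReal.ofReal_le_ofReal ((hηφ _).trans (le_abs_self _))
    rw [mul_comm, ← div_eq_mul_inv, ENNReal.le_div_iff_mul_le (Or.inl (by simpa using hη))
      (Or.inl ENNReal.ofReal_ne_top), mul_comm]
    exact h3

/-- Below the level `m - η²` the speeds are at least `η`, so they may be truncated at `η`. -/
theorem continuousOn_travelTime (hV : Continuous V) {η : ℝ} (hη : 0 < η) (hm : ∀ s, m ≤ V s)
    (x y : ℝ) : ContinuousOn (travelTime V x y) (Iic (m - η ^ 2)) := by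
  have h : Continuous fun l => ∫ s in x..y, (max √(V s - l) η)⁻¹ := by
    refine intervalIntegral.continuous_parametric_intervalIntegral_of_continuous' ?_ x y
    refine Continuous.inv₀ ?_ fun p => (lt_max_of_lt_right hη).ne'
    exact (((hV.comp continuous_snd).sub continuous_fst).sqrt).max continuous_const
  refine h.continuousOn.congr fun l hl => ?_
  refine intervalIntegral.integral_congr fun s _ => ?_
  have : η ≤ √(V s - l) := Real.le_sqrt_of_sq_le (by linarith [hm s, mem_Iic.mp hl])
  simp only [max_eq_left this]

theorem intervalIntegrable_inv_sqrt (hV : Continuous V) (hlam : lam < m) (hm : ∀ s, m ≤ V s)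
    (x y : ℝ) : IntervalIntegrable (fun s => (√(V s - lam))⁻¹) volume x y :=
  ((hV.sub continuous_const).sqrt.inv₀ fun s =>
    (Real.sqrt_pos.mpr (show 0 < V s - lam by linarith [hm s])).ne').intervalIntegrable _ _

theorem travelTime_le (hV : Continuous V) (hlam : lam < m) (hm : ∀ s, m ≤ V s) (hxy : x ≤ y) :
    travelTime V x y lam ≤ (y - x) * (√(m - lam))⁻¹ := by
  have h := intervalIntegral.integral_mono_on hxy (intervalIntegrable_inv_sqrt hV hlam hm x y)
    (intervalIntegrable_const (c := (√(m - lam))⁻¹)) fun s _ =>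
      inv_anti₀ (Real.sqrt_pos.mpr (by linarith)) (Real.sqrt_le_sqrt (by linarith [hm s]))
  rwa [intervalIntegral.integral_const, smul_eq_mul] at h

/-- The level at which the travel time has a prescribed value. -/
theorem exists_travelTime_eq (hV : Continuous V) {η : ℝ} (hη : 0 < η) (hm : ∀ s, m ≤ V s)
    (hxy : x ≤ y) {S : ℝ} (hS : 0 < S) (h : S ≤ travelTime V x y (m - η ^ 2)) :
    ∃ lam ≤ m - η ^ 2, m - η ^ 2 - ((y - x) / S) ^ 2 ≤ lam ∧ travelTime V x y lam = S := by
  set l₁ := m - η ^ 2 - ((y - x) / S) ^ 2 with hl₁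
  have hη2 : 0 < η ^ 2 := by positivity
  have hl : l₁ ≤ m - η ^ 2 := by linarith [sq_nonneg ((y - x) / S)]
  have hxy' : x < y := by
    -- otherwise the travel time would vanish
    rcases hxy.eq_or_lt with rfl | h'
    · simp [travelTime] at h
      linarith
    · exact h'
  have h1 : travelTime V x y l₁ ≤ S := by
    refine (travelTime_le hV (by linarith) hm hxy).trans ?_
    have hpos : 0 < (y - x) / S := div_pos (sub_pos.mpr hxy') hS
    have h2 : (y - x) / S ≤ √(m - l₁) := Real.le_sqrt_of_sq_le (by linarith)
    rw [← div_eq_mul_inv, div_le_iff₀ (hpos.trans_le h2)]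
    rwa [div_le_iff₀ hS, mul_comm] at h2
  obtain ⟨lam, hlam, hlamS⟩ := intermediate_value_Icc hl
    ((continuousOn_travelTime hV hη hm x y).mono fun l hl => hl.2) ⟨h1, h⟩
  exact ⟨lam, hlam.2, hlam.1, hlamS⟩

/-- The case `x ≤ y` of `exists_connection`. -/
theorem exists_connection_of_le (hV : Continuous V) (hm : ∀ s, m ≤ V s) (hM : ∀ s, V s ≤ M)
    {η : ℝ} (hη : 0 < η) (F : ℝ → ℝ≥0∞) (hxy : x ≤ y) (a : ℝ) {S : ℝ} (hS : 0 < S) :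
    ∃ lam ≤ m - η ^ 2, m - η ^ 2 - ((y - x) / S) ^ 2 ≤ lam ∧ ∃ U g, IsPrimitive a (a + S) U g ∧
      U a = x ∧ U (a + S) = y ∧ (∀ t ∈ Icc a (a + S), U t ∈ Icc x y) ∧
      pathEnergy V a (a + S) U g ≤
        lam * S + 2 * (∫ s in x..y, √(V s - lam)) + (V x - m + η ^ 2) * S ∧
      ∫⁻ t in Ioo a (a + S), F (U t) ≤
        ENNReal.ofReal S * F x + (ENNReal.ofReal η)⁻¹ * ∫⁻ s in Icc x y, F s := by
  have hη2 : 0 < η ^ 2 := by positivity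
  have hsp {lam : ℝ} (hl : lam ≤ m - η ^ 2) (s : ℝ) : η ≤ √(V s - lam) :=
    Real.le_sqrt_of_sq_le (by linarith [hm s])
  have hne {lam : ℝ} (hl : lam ≤ m - η ^ 2) : ∀ᵐ s, s ∈ Icc x y → √(V s - lam) ≠ 0 :=
    ae_of_all _ fun s _ => (hη.trans_le (hsp hl s)).ne'
  rcases le_or_gt S (travelTime V x y (m - η ^ 2)) with hT | hT
  · obtain ⟨lam, hl, hl', hlS⟩ := exists_travelTime_eq hV hη hm hxy hS hT
    obtain ⟨U, g, hp, ha, hb, hr, -, hE, hF⟩ := exists_calibrated_path hV hM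
      (fun s => by linarith [hm s]) hxy (hne hl)
      (intervalIntegrable_inv_sqrt hV (by linarith) hm x y) a
    rw [hlS] at hp hb hr hE hF
    refine ⟨lam, hl, hl', U, g, hp, ha, hb, hr, ?_, (hF η hη (hsp hl) F).trans le_add_self⟩
    have : 0 ≤ (V x - m + η ^ 2) * S := mul_nonneg (by linarith [hm x]) hS.le
    linarith
  · -- the path waits at its starting point, and then travels at the level `m - η ^ 2`
    set T := travelTime V x y (m - η ^ 2) with hTdef
    have hT0 : 0 ≤ T := travelTime_nonneg V hxy _
    obtain ⟨U, g, hp, ha, hb, hr, -, hE, hF⟩ := exists_calibrated_path hV hM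
      (lam := m - η ^ 2) (fun s => by linarith [hm s]) hxy (hne le_rfl)
      (intervalIntegrable_inv_sqrt hV (by linarith) hm x y) (a + (S - T))
    rw [← hTdef] at hp hb hr hE hF
    have hend : a + (S - T) + T = a + S := by ring
    rw [hend] at hp hb hr hE hF
    have hw := IsPrimitive.const a (a + (S - T)) x
    have h1 : a ≤ a + (S - T) := by linarith
    have h2 : a + (S - T) ≤ a + S := by linarith
    refine ⟨m - η ^ 2, le_rfl, by linarith [sq_nonneg ((y - x) / S)], _, _,
      hw.glue hp h1 ha.symm, if_pos h1, ?_, fun t ht => ?_, ?_, ?_⟩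
    · rcases h2.eq_or_lt with h | h
      · rw [if_pos h.symm.le, ← ha, h, hb]
      · rw [if_neg (not_le.mpr h), hb]
    · rcases le_or_gt t (a + (S - T)) with h | h
      · simp only [if_pos h]
        exact ⟨le_rfl, hxy⟩
      · simp only [if_neg (not_le.mpr h)]
        exact hr t ⟨h.le, ht.2⟩
    · rw [pathEnergy_glue hw hp h1 h2 ha.symm hV, pathEnergy_const, hE]
      nlinarith [hm x, mul_nonneg (show 0 ≤ V x - m + η ^ 2 by linarith [hm x]) hT0]
    · refine (lintegral_Ioo_glue_le F).trans (add_le_add ?_ (hF η hη (hsp le_rfl) F))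
      rw [setLIntegral_const, Real.volume_Ioo, mul_comm]
      exact mul_le_mul_left (ENNReal.ofReal_le_ofReal (by linarith)) _

/-- Two points can be joined in any time `S`, at a level `lam` that stays below the minimum of `V`
and is controlled by the slope. The path is calibrated, but for the time it waits at one of its end
points; the time it spends elsewhere is controlled through its minimal speed `η`. -/
theorem exists_connection (hV : Continuous V) (hm : ∀ s, m ≤ V s) (hM : ∀ s, V s ≤ M)
    {η : ℝ} (hη : 0 < η) (F : ℝ → ℝ≥0∞) (x y a : ℝ) {S : ℝ} (hS : 0 < S) :
    ∃ lam ≤ m - η ^ 2, m - η ^ 2 - ((y - x) / S) ^ 2 ≤ lam ∧ ∃ U g, IsPrimitive a (a + S) U g ∧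
      U a = x ∧ U (a + S) = y ∧ (∀ t ∈ Icc a (a + S), U t ∈ uIcc x y) ∧
      pathEnergy V a (a + S) U g ≤
        lam * S + 2 * |∫ s in x..y, √(V s - lam)| + (max (V x) (V y) - m + η ^ 2) * S ∧
      ∫⁻ t in Ioo a (a + S), F (U t) ≤
        ENNReal.ofReal S * max (F x) (F y) + (ENNReal.ofReal η)⁻¹ * ∫⁻ s in uIcc x y, F s := by
  rcases le_total x y with hxy | hxy
  · obtain ⟨lam, hl, hl', U, g, hp, ha, hb, hr, hE, hF⟩ :=
      exists_connection_of_le hV hm hM hη F hxy a hS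
    refine ⟨lam, hl, hl', U, g, hp, ha, hb, by rwa [uIcc_of_le hxy], hE.trans ?_, hF.trans ?_⟩
    · gcongr
      · exact le_abs_self _
      · exact le_max_left _ _
    · rw [uIcc_of_le hxy]
      gcongr
      exact le_max_left _ _
  · obtain ⟨lam, hl, hl', U, g, hp, ha, hb, hr, hE, hF⟩ :=
      exists_connection_of_le hV hm hM hη F hxy a hS
    have hrev := hp.reverse (by linarith)
    have hsq : ((y - x) / S) ^ 2 = ((x - y) / S) ^ 2 := by ring
    refine ⟨lam, hl, by rwa [hsq], _, _, hrev, ?_, ?_, fun t ht => ?_, ?_, ?_⟩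
    · rw [add_sub_cancel_left, hb]
    · rw [add_sub_cancel_right, ha]
    · rw [uIcc_of_ge hxy]
      exact hr _ ⟨by linarith [ht.2], by linarith [ht.1]⟩
    · rw [pathEnergy_reverse, intervalIntegral.integral_symm, abs_neg]
      refine hE.trans ?_
      gcongr
      · exact le_abs_self _
      · exact le_max_right _ _
    · rw [lintegral_Ioo_reverse, uIcc_of_ge hxy]
      refine hF.trans ?_
      gcongr
      exact le_max_right _ _

end Connection

/-! ### The space `H¹₀` -/

theorem L2Interval.inner_eq_integral {a b : ℝ} (f g : L2Interval a b) :
    inner ℝ f g = ∫ t in Ioo a b, f t * g t := by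
  rw [L2.inner_def]
  exact integral_congr_ae (ae_of_all _ fun t => by simp [mul_comm])

theorem IsPrimitive.integral_mul_add {a b : ℝ} {U g P q : ℝ → ℝ} (h : IsPrimitive a b U g)
    (h' : IsPrimitive a b P q) (hab : a ≤ b) :
    ∫ t in Ioo a b, (q t * U t + P t * g t) = P b * U b - P a * U a := by
  have h1 := (h'.absolutelyContinuous hab).integral_deriv_mul_eq_sub (h.absolutelyContinuous hab)
  simp only [← h.eq_add_integral b (right_mem_Icc.mpr hab),
    ← h'.eq_add_integral b (right_mem_Icc.mpr hab), intervalIntegral.integral_same, add_zero] at h1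
  rw [← h1, ← integral_Ioc_eq_integral_Ioo, ← intervalIntegral.integral_of_le hab]
  refine intervalIntegral.integral_congr_ae ?_
  filter_upwards [h.ae_hasDerivAt hab, h'.ae_hasDerivAt hab] with t ht ht' htm
  rw [uIoc_of_le hab] at htm
  have hm := Ioc_subset_Icc_self htm
  rw [(ht hm).deriv, (ht' hm).deriv, h.eq_add_integral t hm, h'.eq_add_integral t hm]

theorem IsTestFunction.isPrimitive {a b : ℝ} {φ : ℝ → ℝ} (h : IsTestFunction a b φ) :
    IsPrimitive a b φ (deriv φ) :=
  IsPrimitive.of_hasDerivAt h.smooth.continuous.continuousOn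
    h.continuous_deriv.continuousOn
    fun t _ => (h.smooth.differentiable (by simp) t).hasDerivAt

/-- The integral of the derivative over a measurable set, a continuous functional on `H¹`. -/
theorem exists_clm_eq_integral_h1Deriv {a b : ℝ} {s : Set ℝ} (hs : MeasurableSet s) :
    ∃ l : H1Interval a b →L[ℝ] ℝ, ∀ u, l u = ∫ t in s, h1Deriv u t ∂(volume.restrict (Ioo a b)) := by
  have hfin : (volume.restrict (Ioo a b)) s ≠ ⊤ := measure_ne_top _ _
  refine ⟨((innerSL ℝ (indicatorConstLp 2 hs hfin (1 : ℝ))).comp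
    (WithLp.sndL 2 ℝ (L2Interval a b) (L2Interval a b))).comp (H1Interval a b).subtypeL, fun u => ?_⟩
  rw [← L2.inner_indicatorConstLp_one hs hfin]
  rfl

/-- The test functions, as elements of `H¹`. -/
def testSubmodule (a b : ℝ) : Submodule ℝ (H1Interval a b) where
  carrier := {u | ∃ φ : ℝ → ℝ, IsTestFunction a b φ ∧ h1Val u =ᵐ[volume.restrict (Ioo a b)] φ}
  zero_mem' := ⟨fun _ => 0, ⟨contDiff_const, HasCompactSupport.zero, by simp [tsupport]⟩,
    Lp.coeFn_zero _ _ _⟩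
  add_mem' := by
    rintro u v ⟨φ, hφ, hu⟩ ⟨ψ, hψ, hv⟩
    refine ⟨_, hφ.sub_const_mul hψ (-1), ?_⟩
    filter_upwards [Lp.coeFn_add (h1Val u) (h1Val v), hu, hv] with t h1 h2 h3
    change (h1Val u + h1Val v) t = _
    rw [h1, Pi.add_apply, h2, h3]
    ring
  smul_mem' := by
    rintro c u ⟨φ, hφ, hu⟩
    refine ⟨_, hφ.sub_const_mul hφ (1 - c), ?_⟩
    filter_upwards [Lp.coeFn_smul c (h1Val u), hu] with t h1 h2
    change (c • h1Val u) t = _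
    rw [h1, Pi.smul_apply, h2, smul_eq_mul]
    ring

theorem integral_h1Deriv_eq_zero_of_mem {a b : ℝ} (hab : a < b) {u : H1Interval a b}
    (hu : u ∈ H10Interval a b) : ∫ t in Ioo a b, h1Deriv u t = 0 := by
  obtain ⟨l, hl⟩ := exists_clm_eq_integral_h1Deriv (a := a) (b := b) MeasurableSet.univ
  simp only [Measure.restrict_univ] at hl
  rw [← hl]
  refine closure_minimal (t := {u | l u = 0}) ?_ (isClosed_eq l.continuous continuous_const) hu
  rintro u ⟨φ, hφ, hφu⟩
  obtain ⟨U, hU, hUu⟩ := H1Interval.exists_isPrimitive hab u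
  have h1 : EqOn U φ (Ioo a b) := Measure.eqOn_open_of_ae_eq (hUu.symm.trans hφu) isOpen_Ioo
    ((hU.continuousOn hab.le).mono Ioo_subset_Icc_self) hφ.smooth.continuous.continuousOn
  have h2 : EqOn U φ (Icc a b) := h1.of_subset_closure (hU.continuousOn hab.le)
    hφ.smooth.continuous.continuousOn Ioo_subset_Icc_self (closure_Ioo hab.ne).symm.subset
  have ha : φ a = 0 := image_eq_zero_of_notMem_tsupport fun h => (hφ.support_subset h).1.false
  have hb : φ b = 0 := image_eq_zero_of_notMem_tsupport fun h => (hφ.support_subset h).2.false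
  have h3 := hU.sub_eq_integral hab.le (left_mem_Icc.mpr hab.le) (right_mem_Icc.mpr hab.le)
  rw [intervalIntegral.integral_of_le hab.le, integral_Ioc_eq_integral_Ioo,
    h2 (left_mem_Icc.mpr hab.le), h2 (right_mem_Icc.mpr hab.le), ha, hb] at h3
  change l u = 0
  rw [hl, ← h3, sub_zero]

/-- An element of `H¹` that vanishes at the end points belongs to `H¹₀`: a pair orthogonal to all
`(φ, φ')` has the form `(w', w)` with `w ∈ H¹`, hence it is orthogonal to `(u, u')`, too. -/
theorem mem_H10Interval_of_eq_zero {a b : ℝ} (hab : a < b) {u : H1Interval a b} {U g : ℝ → ℝ}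
    (hU : IsPrimitive a b U g) (hUu : h1Val u =ᵐ[volume.restrict (Ioo a b)] U)
    (hgu : h1Deriv u =ᵐ[volume.restrict (Ioo a b)] g) (ha : U a = 0) (hb : U b = 0) :
    u ∈ H10Interval a b := by
  change u ∈ closure (testSubmodule a b : Set (H1Interval a b))
  rw [closure_subtype]
  set K := (testSubmodule a b).map (H1Interval a b).subtype with hK
  have hKc : (Subtype.val '' (testSubmodule a b : Set (H1Interval a b))) = (K : Set _) := by
    rw [hK, Submodule.map_coe]
    rfl
  rw [hKc, ← Submodule.topologicalClosure_coe, ← K.orthogonal_orthogonal_eq_closure]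
  refine (Submodule.mem_orthogonal _ _).mpr fun p hp => ?_
  rw [Submodule.mem_orthogonal] at hp
  have hw : HasWeakDeriv a b p.snd p.fst := by
    intro φ hφ
    obtain ⟨v, hv1, hv2⟩ := hφ.isPrimitive.exists_h1 hab
    have h1 := hp v.1 ⟨v, ⟨φ, hφ, hv1⟩, rfl⟩
    have h2 : inner ℝ (h1Val v) p.fst + inner ℝ (h1Deriv v) p.snd = 0 := h1
    rw [L2Interval.inner_eq_integral, L2Interval.inner_eq_integral] at h2
    have h3 : ∫ t in Ioo a b, h1Val v t * p.fst t = ∫ t in Ioo a b, p.fst t * φ t :=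
      integral_congr_ae (hv1.mono fun t ht => by simp only [ht]; ring)
    have h4 : ∫ t in Ioo a b, h1Deriv v t * p.snd t = ∫ t in Ioo a b, p.snd t * deriv φ t :=
      integral_congr_ae (hv2.mono fun t ht => by simp only [ht]; ring)
    linarith
  obtain ⟨P, hP, hPp⟩ := H1Interval.exists_isPrimitive hab ⟨WithLp.toLp 2 (p.snd, p.fst), hw⟩
  have hP' : IsPrimitive a b P p.fst := hP
  have hPp' : p.snd =ᵐ[volume.restrict (Ioo a b)] P := hPp
  have h5 := hU.integral_mul_add hP' hab.le
  rw [ha, hb, mul_zero, mul_zero, sub_zero] at h5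
  change inner ℝ p.fst (h1Val u) + inner ℝ p.snd (h1Deriv u) = 0
  rw [L2Interval.inner_eq_integral, L2Interval.inner_eq_integral, ← h5, ← integral_add]
  · refine integral_congr_ae ?_
    filter_upwards [hUu, hgu, hPp'] with t h1 h2 h3
    rw [h1, h2, h3]
  · exact (Lp.memLp _).integrable_mul (Lp.memLp _)
  · exact (Lp.memLp _).integrable_mul (Lp.memLp _)

/-! ### The cell problem and the homogenized integrand -/

section Cell

variable {V : ℝ → ℝ} {m M lam : ℝ}

theorem Function.Periodic.exists_min (hV : Continuous V) (hper : Function.Periodic V 1) :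
    ∃ x₀ ∈ Icc (0 : ℝ) 1, ∀ x, V x₀ ≤ V x := by
  obtain ⟨x₀, hx₀, hmin⟩ := isCompact_Icc.exists_isMinOn (s := Icc (0 : ℝ) 1) ⟨0, by simp⟩
    hV.continuousOn
  refine ⟨x₀, hx₀, fun x => ?_⟩
  obtain ⟨y, hy, hxy⟩ := hper.exists_mem_Ico₀ one_pos x
  rw [hxy]
  exact hmin ⟨hy.1, hy.2.le⟩

theorem Function.Periodic.exists_max (hV : Continuous V) (hper : Function.Periodic V 1) :
    ∃ M, ∀ x, V x ≤ M := by
  obtain ⟨x₀, -, hmax⟩ := isCompact_Icc.exists_isMaxOn (s := Icc (0 : ℝ) 1) ⟨0, by simp⟩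
    hV.continuousOn
  refine ⟨V x₀, fun x => ?_⟩
  obtain ⟨y, hy, hxy⟩ := hper.exists_mem_Ico₀ one_pos x
  rw [hxy]
  exact hmax ⟨hy.1, hy.2.le⟩

theorem IsPrimitive.add_linear {a b : ℝ} {U g : ℝ → ℝ} (h : IsPrimitive a b U g)
    (ξ : ℝ) : IsPrimitive a b (fun t => U t + ξ * t) (fun t => g t + ξ) where
  memLp := h.memLp.add (memLp_const ξ)
  eq_add_integral t ht := by
    rw [intervalIntegral.integral_add ((h.mono le_rfl ht.1 ht.2).intervalIntegrable ht.1)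
      intervalIntegrable_const, intervalIntegral.integral_const, h.eq_add_integral t ht, smul_eq_mul]
    ring

theorem IsPrimitive.sub_const {a b : ℝ} {U g : ℝ → ℝ} (h : IsPrimitive a b U g) (c : ℝ) :
    IsPrimitive a b (fun t => U t - c) g where
  memLp := h.memLp
  eq_add_integral t ht := by
    rw [h.eq_add_integral t ht]
    ring

theorem cellEnergy_eq_pathEnergy {ξ : ℝ} (v : H1Interval 0 (1 / |ξ|))
    {U g : ℝ → ℝ} (hU : h1Val v =ᵐ[volume.restrict (Ioo 0 (1 / |ξ|))] U)
    (hg : h1Deriv v =ᵐ[volume.restrict (Ioo 0 (1 / |ξ|))] g) :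
    cellEnergy V ξ v =
      |ξ| * pathEnergy V 0 (1 / |ξ|) (fun t => U t + ξ * t) (fun t => g t + ξ) := by
  have hT : 0 ≤ 1 / |ξ| := by positivity
  unfold cellEnergy pathEnergy
  rw [intervalIntegral.integral_of_le hT, integral_Ioc_eq_integral_Ioo]
  congr 1
  refine integral_congr_ae ?_
  filter_upwards [hU, hg] with t h1 h2
  rw [h1, h2]

theorem two_mul_integral_sqrt_add_one (hper : Function.Periodic V 1) (x : ℝ) :
    2 * ∫ s in x..x + 1, √(V s - lam) = crossingCost V lam := by
  have hp : Function.Periodic (fun s => √(V s - lam)) 1 := fun s => by simp only [hper s]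
  rw [hp.intervalIntegral_add_eq x 0, zero_add]
  rfl

theorem two_mul_abs_integral_sqrt (hper : Function.Periodic V 1) {x y : ℝ} (h : |y - x| = 1) :
    2 * |∫ s in x..y, √(V s - lam)| = crossingCost V lam := by
  have h0 (x : ℝ) : |∫ s in x..x + 1, √(V s - lam)| = ∫ s in x..x + 1, √(V s - lam) :=
    abs_of_nonneg (intervalIntegral.integral_nonneg (by linarith) fun _ _ => Real.sqrt_nonneg _)
  rcases eq_or_eq_neg_of_abs_eq h with h1 | h1
  · obtain rfl : y = x + 1 := by linarith
    rw [h0, two_mul_integral_sqrt_add_one hper]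
  · obtain rfl : x = y + 1 := by linarith
    rw [intervalIntegral.integral_symm, abs_neg, h0, two_mul_integral_sqrt_add_one hper]

theorem abs_mul_one_div_abs {ξ : ℝ} (hξ : ξ ≠ 0) : |ξ * (1 / |ξ|)| = 1 := by
  rw [abs_mul, abs_div, abs_one, abs_abs, mul_one_div_cancel (abs_ne_zero.mpr hξ)]

/-- The calibration inequality for the cell problem: the competitors cross exactly one period. -/
theorem le_cellEnergy (hV : Continuous V) (hper : Function.Periodic V 1)
    (hM : ∀ x, V x ≤ M) (hlam : ∀ x, lam ≤ V x) {ξ : ℝ} (hξ : ξ ≠ 0) {v : H1Interval 0 (1 / |ξ|)}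
    (hv : v ∈ H10Interval 0 (1 / |ξ|)) :
    lam + crossingCost V lam * |ξ| ≤ cellEnergy V ξ v := by
  have hξ' : 0 < |ξ| := abs_pos.mpr hξ
  have hT : 0 < 1 / |ξ| := by positivity
  obtain ⟨U, hU, hUv⟩ := H1Interval.exists_isPrimitive hT v
  rw [cellEnergy_eq_pathEnergy v hUv (ae_eq_refl _)]
  have hz := integral_h1Deriv_eq_zero_of_mem hT hv
  have hUT : U (1 / |ξ|) - U 0 = 0 := by
    rw [hU.sub_eq_integral hT.le (left_mem_Icc.mpr hT.le) (right_mem_Icc.mpr hT.le),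
      intervalIntegral.integral_of_le hT.le, integral_Ioc_eq_integral_Ioo, hz]
  have hlin := (hU.add_linear ξ).le_pathEnergy hT.le hV hM hlam
  rw [two_mul_abs_integral_sqrt hper] at hlin
  · have h := mul_le_mul_of_nonneg_left hlin hξ'.le
    refine le_trans (le_of_eq ?_) h
    field_simp
    ring
  · have h1 : U (1 / |ξ|) + ξ * (1 / |ξ|) - (U 0 + ξ * 0) = ξ * (1 / |ξ|) := by linarith
    rw [h1, abs_mul_one_div_abs hξ]

/-- The singular case: if the travel times at the levels below the minimum `m` are bounded by `T`,
then so is the travel time at the level `m`, by Fatou's lemma. -/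
theorem integrable_inv_sqrt_of_travelTime_le (hV : Continuous V) (hm : ∀ x, m ≤ V x) {T : ℝ}
    (h : ∀ lam < m, travelTime V 0 1 lam ≤ T) :
    (∀ᵐ s, s ∈ Icc (0 : ℝ) 1 → √(V s - m) ≠ 0) ∧
      IntervalIntegrable (fun s => (√(V s - m))⁻¹) volume 0 1 ∧ travelTime V 0 1 m ≤ T := by
  have hφ (lam : ℝ) : Continuous fun s => √(V s - lam) := (hV.sub continuous_const).sqrt
  -- with values in `[0,∞]`, the reciprocal of the speed is `∞` where the speed vanishes
  set l : ℕ → ℝ := fun n => m - 1 / ((n : ℝ) + 1) with hl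
  have hlm (n : ℕ) : l n < m := sub_lt_self _ (by positivity)
  have hllim : Tendsto l atTop (𝓝 m) := by
    have := (tendsto_const_nhds (x := m)).sub (tendsto_one_div_add_atTop_nhds_zero_nat (𝕜 := ℝ))
    rwa [sub_zero] at this
  set F : ℝ → ℝ → ℝ≥0∞ := fun lam s => (ENNReal.ofReal √(V s - lam))⁻¹ with hF
  have hFm (lam : ℝ) : Measurable (F lam) := (ENNReal.measurable_ofReal.comp (hφ lam).measurable).inv
  have hlim (s : ℝ) : Tendsto (fun n => F (l n) s) atTop (𝓝 (F m s)) := by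
    refine (continuous_inv.tendsto _).comp ((ENNReal.continuous_ofReal.tendsto _).comp ?_)
    exact (Real.continuous_sqrt.tendsto _).comp (tendsto_const_nhds.sub hllim)
  have hle (n : ℕ) : ∫⁻ s in Ioc (0 : ℝ) 1, F (l n) s ≤ ENNReal.ofReal T := by
    have h1 := intervalIntegrable_inv_sqrt hV (hlm n) hm 0 1
    have h2 : ∫⁻ s in Ioc (0 : ℝ) 1, F (l n) s =
        ∫⁻ s in Ioc (0 : ℝ) 1, ENNReal.ofReal (√(V s - l n))⁻¹ := by
      refine lintegral_congr fun s => ?_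
      rw [hF, ENNReal.ofReal_inv_of_pos]
      exact Real.sqrt_pos.mpr (by linarith [hm s, hlm n])
    rw [h2, ← ofReal_integral_eq_lintegral_ofReal h1.1
      (ae_of_all _ fun s => inv_nonneg.mpr (Real.sqrt_nonneg _)),
      ← intervalIntegral.integral_of_le zero_le_one]
    exact ENNReal.ofReal_le_ofReal (h _ (hlm n))
  have hfatou : ∫⁻ s in Ioc (0 : ℝ) 1, F m s ≤ ENNReal.ofReal T := by
    calc ∫⁻ s in Ioc (0 : ℝ) 1, F m s
        = ∫⁻ s in Ioc (0 : ℝ) 1, liminf (fun n => F (l n) s) atTop :=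
          lintegral_congr fun s => (hlim s).liminf_eq.symm
      _ ≤ liminf (fun n => ∫⁻ s in Ioc (0 : ℝ) 1, F (l n) s) atTop :=
          lintegral_liminf_le fun n => hFm _
      _ ≤ ENNReal.ofReal T := liminf_le_of_frequently_le' (Frequently.of_forall hle)
  have hae : ∀ᵐ s ∂(volume.restrict (Ioc (0 : ℝ) 1)), √(V s - m) ≠ 0 := by
    filter_upwards [ae_lt_top (hFm m) (hfatou.trans_lt ENNReal.ofReal_lt_top).ne] with s hs h0
    simp [hF, h0] at hs
  have heq : ∫⁻ s in Ioc (0 : ℝ) 1, ENNReal.ofReal (√(V s - m))⁻¹ =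
      ∫⁻ s in Ioc (0 : ℝ) 1, F m s := by
    refine lintegral_congr_ae ?_
    filter_upwards [hae] with s hs
    rw [hF, ENNReal.ofReal_inv_of_pos ((Real.sqrt_nonneg _).lt_of_ne' hs)]
  have hmeas : Measurable fun s => (√(V s - m))⁻¹ := (hφ m).measurable.inv
  have hint : IntegrableOn (fun s => (√(V s - m))⁻¹) (Ioc 0 1) := by
    refine ⟨hmeas.aestronglyMeasurable, ?_⟩
    rw [hasFiniteIntegral_iff_ofReal (ae_of_all _ fun s => inv_nonneg.mpr (Real.sqrt_nonneg _)), heq]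
    exact hfatou.trans_lt ENNReal.ofReal_lt_top
  refine ⟨?_, (intervalIntegrable_iff_integrableOn_Ioc_of_le zero_le_one).mpr hint, ?_⟩
  · rw [ae_restrict_iff' measurableSet_Ioc] at hae
    filter_upwards [hae, Measure.ae_ne volume (0 : ℝ)] with s hs h0 hm
    exact hs ⟨hm.1.lt_of_ne' h0, hm.2⟩
  · have h0 : 0 ≤ T := (travelTime_nonneg V zero_le_one _).trans (h (l 0) (hlm 0))
    unfold travelTime
    rw [intervalIntegral.integral_of_le zero_le_one,
      integral_eq_lintegral_of_nonneg_ae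
        (ae_of_all _ fun s => inv_nonneg.mpr (Real.sqrt_nonneg _)) hmeas.aestronglyMeasurable, heq]
    exact ENNReal.toReal_le_of_le_ofReal h0 hfatou

/-- A path that crosses one period in the time `T` at a constant level `lam`, at the cost `c(lam)`;
if `T` is larger than the travel time at the level `min V`, it waits at a minimum point of `V`. -/
theorem exists_crossing_path (hV : Continuous V) (hper : Function.Periodic V 1) {T : ℝ}
    (hT : 0 < T) :
    ∃ lam, (∀ x, lam ≤ V x) ∧ ∃ U g, IsPrimitive 0 T U g ∧ U 0 = 0 ∧ U T = 1 ∧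
      pathEnergy V 0 T U g = lam * T + crossingCost V lam := by
  obtain ⟨M, hM⟩ := hper.exists_max hV
  obtain ⟨x₀, hx₀, hmin⟩ := hper.exists_min hV
  by_cases hcase : ∃ l < V x₀, T < travelTime V 0 1 l
  · obtain ⟨l, hl, hTl⟩ := hcase
    have hη : 0 < √(V x₀ - l) := Real.sqrt_pos.mpr (by linarith)
    have hηsq : V x₀ - √(V x₀ - l) ^ 2 = l := by
      rw [Real.sq_sqrt (by linarith)]
      ring
    obtain ⟨lam, hlam, -, hlamT⟩ := exists_travelTime_eq hV hη hmin zero_le_one hT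
      (by rw [hηsq]; exact hTl.le)
    have hlt : lam < V x₀ := by linarith
    have hle (x : ℝ) : lam ≤ V x := hlt.le.trans (hmin x)
    obtain ⟨U, g, hp, ha, hb, -, -, hE, -⟩ := exists_calibrated_path hV hM hle zero_le_one
      (ae_of_all _ fun s _ => (Real.sqrt_pos.mpr (by linarith [hmin s])).ne')
      (intervalIntegrable_inv_sqrt hV hlt hmin 0 1) 0
    rw [hlamT, zero_add] at hp hb hE
    exact ⟨lam, hle, U, g, hp, ha, hb, hE⟩
  · push Not at hcase
    obtain ⟨hne, hint, hle⟩ := integrable_inv_sqrt_of_travelTime_le hV hmin hcase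
    have hi1 : IntervalIntegrable (fun s => (√(V s - V x₀))⁻¹) volume 0 x₀ :=
      hint.mono_set (by
        rw [uIcc_of_le hx₀.1, uIcc_of_le zero_le_one]; exact Icc_subset_Icc_right hx₀.2)
    have hi2 : IntervalIntegrable (fun s => (√(V s - V x₀))⁻¹) volume x₀ 1 :=
      hint.mono_set (by
        rw [uIcc_of_le hx₀.2, uIcc_of_le zero_le_one]; exact Icc_subset_Icc_left hx₀.1)
    set τ₁ := travelTime V 0 x₀ (V x₀) with hτ₁
    set τ₂ := travelTime V x₀ 1 (V x₀) with hτ₂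
    have hτ : τ₁ + τ₂ = travelTime V 0 1 (V x₀) :=
      intervalIntegral.integral_add_adjacent_intervals hi1 hi2
    have hτ₁0 : 0 ≤ τ₁ := travelTime_nonneg V hx₀.1 _
    have hτ₂0 : 0 ≤ τ₂ := travelTime_nonneg V hx₀.2 _
    obtain ⟨U₁, g₁, hp₁, ha₁, hb₁, -, -, hE₁, -⟩ := exists_calibrated_path hV hM hmin hx₀.1
      (hne.mono fun s hs h => hs ⟨h.1, h.2.trans hx₀.2⟩) hi1 0
    obtain ⟨U₂, g₂, hp₂, ha₂, hb₂, -, -, hE₂, -⟩ := exists_calibrated_path hV hM hmin hx₀.2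
      (hne.mono fun s hs h => hs ⟨hx₀.1.trans h.1, h.2⟩) hi2 (T - τ₂)
    rw [zero_add, ← hτ₁] at hp₁ hb₁ hE₁
    rw [← hτ₂, sub_add_cancel] at hp₂ hb₂ hE₂
    have h12 : τ₁ ≤ T - τ₂ := by linarith
    have hw := IsPrimitive.const τ₁ (T - τ₂) x₀
    have hp₁w := hp₁.glue hw hτ₁0 hb₁
    have hc : (fun t => if t ≤ τ₁ then U₁ t else x₀) (T - τ₂) = U₂ (T - τ₂) := by
      rw [ha₂]
      rcases h12.eq_or_lt with h | h
      · simp only [if_pos h.symm.le]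
        rw [← h, hb₁]
      · exact if_neg (not_le.mpr h)
    have h02 : 0 ≤ T - τ₂ := hτ₁0.trans h12
    have h2T : T - τ₂ ≤ T := by linarith
    refine ⟨V x₀, hmin, _, _, hp₁w.glue hp₂ h02 hc, ?_, ?_, ?_⟩
    · simp only [if_pos h02, if_pos hτ₁0, ha₁]
    · rcases h2T.eq_or_lt with h | h
      · simp only [if_pos h.symm.le]
        rw [h] at hc ha₂
        rw [← hb₂]
        exact hc
      · simp only [if_neg (not_le.mpr h), hb₂]
    · rw [pathEnergy_glue hp₁w hp₂ h02 h2T hc hV, pathEnergy_glue hp₁ hw hτ₁0 h12 hb₁ hV,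
        pathEnergy_const, hE₁, hE₂]
      have hφ : Continuous fun s => √(V s - V x₀) := (hV.sub continuous_const).sqrt
      unfold crossingCost
      rw [← intervalIntegral.integral_add_adjacent_intervals (hφ.intervalIntegrable 0 x₀)
        (hφ.intervalIntegrable x₀ 1)]
      ring

theorem exists_cell_minimizer (hV : Continuous V) (hper : Function.Periodic V 1) {ξ : ℝ}
    (hξ : ξ ≠ 0) : ∃ lam, (∀ x, lam ≤ V x) ∧ ∃ v ∈ H10Interval 0 (1 / |ξ|),
      cellEnergy V ξ v = lam + crossingCost V lam * |ξ| := by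
  have hξ' : 0 < |ξ| := abs_pos.mpr hξ
  have hT : 0 < 1 / |ξ| := by positivity
  obtain ⟨lam, hlam, U, g, hp, h0, h1, hE⟩ := exists_crossing_path hV hper hT
  have key : ∃ P q, IsPrimitive 0 (1 / |ξ|) P q ∧ P 0 = 0 ∧ P (1 / |ξ|) = ξ * (1 / |ξ|) ∧
      pathEnergy V 0 (1 / |ξ|) P q = lam * (1 / |ξ|) + crossingCost V lam := by
    -- for negative slopes the path is traversed backwards
    rcases lt_or_gt_of_ne hξ with h | h
    · refine ⟨_, _, (hp.reverse hT.le).sub_const 1, ?_, ?_, ?_⟩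
      · simp only [zero_add, sub_zero, h1, sub_self]
      · simp only [zero_add, sub_self, h0]
        rw [abs_of_neg h]
        field_simp
        norm_num
      · rw [← hE, ← pathEnergy_reverse (U := U)]
        refine intervalIntegral.integral_congr fun t _ => ?_
        simp only [hper.sub_eq]
    · exact ⟨U, g, hp, h0, by rw [h1, abs_of_pos h, mul_one_div_cancel hξ], hE⟩
  obtain ⟨P, q, hP, hP0, hP1, hPE⟩ := key
  have hv := hP.add_linear (-ξ)
  obtain ⟨v, hv1, hv2⟩ := hv.exists_h1 hT
  refine ⟨lam, hlam, v, mem_H10Interval_of_eq_zero hT hv hv1 hv2 (by simp [hP0]) ?_, ?_⟩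
  · rw [hP1]
    ring
  · rw [cellEnergy_eq_pathEnergy v hv1 hv2]
    have h2 : pathEnergy V 0 (1 / |ξ|) (fun t => P t + -ξ * t + ξ * t) (fun t => q t + -ξ + ξ) =
        pathEnergy V 0 (1 / |ξ|) P q := by
      congr 1 <;> funext t <;> ring
    rw [h2, hPE]
    field_simp

end Cell

section Fhom

variable {V : ℝ → ℝ} {m M lam : ℝ}

theorem isLeast_range_fhom_zero (hV : Continuous V) (hper : Function.Periodic V 1) :
    IsLeast (range V) (fhom V 0) := by
  obtain ⟨x₀, -, hmin⟩ := hper.exists_min hV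
  have h : IsLeast (range V) (V x₀) := ⟨mem_range_self _, by rintro _ ⟨x, rfl⟩; exact hmin x⟩
  rw [fhom, if_pos rfl, h.csInf_eq]
  exact h

theorem exists_isLeast_cellEnergy (hV : Continuous V) (hper : Function.Periodic V 1) {ξ : ℝ}
    (hξ : ξ ≠ 0) : ∃ lam, (∀ x, lam ≤ V x) ∧
      IsLeast (cellEnergy V ξ '' H10Interval 0 (1 / |ξ|)) (lam + crossingCost V lam * |ξ|) := by
  obtain ⟨M, hM⟩ := hper.exists_max hV
  obtain ⟨lam, hlam, v, hv, hE⟩ := exists_cell_minimizer hV hper hξ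
  refine ⟨lam, hlam, ⟨v, hv, hE⟩, ?_⟩
  rintro _ ⟨w, hw, rfl⟩
  exact le_cellEnergy hV hper hM hlam hξ hw

theorem isLeast_cellEnergy_fhom (hV : Continuous V) (hper : Function.Periodic V 1) {ξ : ℝ}
    (hξ : ξ ≠ 0) : IsLeast (cellEnergy V ξ '' H10Interval 0 (1 / |ξ|)) (fhom V ξ) := by
  obtain ⟨lam, -, h⟩ := exists_isLeast_cellEnergy hV hper hξ
  rw [fhom, if_neg hξ, h.csInf_eq]
  exact h

/-- The upper half of the dual formula `f_hom(ξ) = max {lam + c(lam) |ξ| : lam ≤ min V}`. -/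
theorem exists_fhom_eq (hV : Continuous V) (hper : Function.Periodic V 1) (ξ : ℝ) :
    ∃ lam, (∀ x, lam ≤ V x) ∧ fhom V ξ = lam + crossingCost V lam * |ξ| := by
  rcases eq_or_ne ξ 0 with rfl | hξ
  · have h := isLeast_range_fhom_zero hV hper
    exact ⟨fhom V 0, fun x => h.2 (mem_range_self x), by simp⟩
  · obtain ⟨lam, hlam, h⟩ := exists_isLeast_cellEnergy hV hper hξ
    exact ⟨lam, hlam, (isLeast_cellEnergy_fhom hV hper hξ).unique h⟩

/-- The lower half of the dual formula `f_hom(ξ) = max {lam + c(lam) |ξ| : lam ≤ min V}`. -/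
theorem le_fhom (hV : Continuous V) (hper : Function.Periodic V 1) (hlam : ∀ x, lam ≤ V x)
    (ξ : ℝ) : lam + crossingCost V lam * |ξ| ≤ fhom V ξ := by
  obtain ⟨M, hM⟩ := hper.exists_max hV
  rcases eq_or_ne ξ 0 with rfl | hξ
  · obtain ⟨x, hx⟩ := (isLeast_range_fhom_zero hV hper).1
    simpa [← hx] using hlam x
  · obtain ⟨v, hv, hE⟩ := (isLeast_cellEnergy_fhom hV hper hξ).1
    rw [← hE]
    exact le_cellEnergy hV hper hM hlam hξ hv

/-- `f_hom` is a maximum of convex functions. -/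
theorem convexOn_fhom (hV : Continuous V) (hper : Function.Periodic V 1) :
    ConvexOn ℝ univ (fhom V) := by
  refine ⟨convex_univ, fun ξ _ ζ _ a b ha hb hab => ?_⟩
  obtain ⟨lam, hlam, h⟩ := exists_fhom_eq hV hper (a • ξ + b • ζ)
  have h1 := mul_le_mul_of_nonneg_left (le_fhom hV hper hlam ξ) ha
  have h2 := mul_le_mul_of_nonneg_left (le_fhom hV hper hlam ζ) hb
  have h3 : |a • ξ + b • ζ| ≤ a * |ξ| + b * |ζ| := by
    refine (abs_add_le _ _).trans (le_of_eq ?_)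
    rw [smul_eq_mul, smul_eq_mul, abs_mul, abs_mul, abs_of_nonneg ha, abs_of_nonneg hb]
  have h4 := mul_le_mul_of_nonneg_left h3 (crossingCost_nonneg V lam)
  rw [h]
  simp only [smul_eq_mul] at h3 h4 ⊢
  obtain rfl : b = 1 - a := by linarith
  nlinarith

theorem continuous_fhom (hV : Continuous V) (hper : Function.Periodic V 1) :
    Continuous (fhom V) :=
  continuousOn_univ.mp ((convexOn_fhom hV hper).continuousOn isOpen_univ)

theorem le_fhom_of_forall_le (hV : Continuous V) (hper : Function.Periodic V 1)
    (hm : ∀ x, m ≤ V x) (ξ : ℝ) : m ≤ fhom V ξ :=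
  (le_add_of_nonneg_right (mul_nonneg (crossingCost_nonneg V m) (abs_nonneg ξ))).trans
    (le_fhom hV hper hm ξ)

theorem fhom_le (hV : Continuous V) (hper : Function.Periodic V 1) (hM : ∀ x, V x ≤ M) (ξ : ℝ) :
    fhom V ξ ≤ M + ξ ^ 2 := by
  obtain ⟨lam, hlam, h⟩ := exists_fhom_eq hV hper ξ
  rw [h]
  have h1 := mul_le_mul_of_nonneg_right (crossingCost_le hV hM lam) (abs_nonneg ξ)
  have h2 := Real.sq_sqrt (show 0 ≤ M - lam by linarith [hlam 0, hM 0])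
  nlinarith [sq_nonneg (√(M - lam) - |ξ|), sq_abs ξ]

theorem integrable_fhom_comp (hV : Continuous V) (hper : Function.Periodic V 1) {a b : ℝ}
    {g : ℝ → ℝ} (hg : MemLp g 2 (volume.restrict (Ioo a b))) :
    Integrable (fun t => fhom V (g t)) (volume.restrict (Ioo a b)) := by
  obtain ⟨M, hM⟩ := hper.exists_max hV
  obtain ⟨x₀, -, hmin⟩ := hper.exists_min hV
  refine Integrable.mono' (((integrable_const (|V x₀| + |M|)).add hg.integrable_sq))
    ((continuous_fhom hV hper).comp_aestronglyMeasurable hg.aestronglyMeasurable)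
    (ae_of_all _ fun t => ?_)
  rw [Real.norm_eq_abs, abs_le, Pi.add_apply]
  have h1 := le_fhom_of_forall_le hV hper hmin (g t)
  have h2 := fhom_le hV hper hM (g t)
  constructor
  · nlinarith [neg_abs_le (V x₀), abs_nonneg M, sq_nonneg (g t)]
  · nlinarith [le_abs_self M, abs_nonneg (V x₀)]

end Fhom

/-! ### The lower bound -/

section LowerBound

variable {V : ℝ → ℝ} {m M lam : ℝ}

theorem periodicEnergy_eq_pathEnergy {ε : ℝ} (u : H1Interval 0 1) {U g : ℝ → ℝ}
    (hU : h1Val u =ᵐ[volume.restrict (Ioo 0 1)] U)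
    (hg : h1Deriv u =ᵐ[volume.restrict (Ioo 0 1)] g) :
    periodicEnergy V ε u = pathEnergy (fun x => V (x / ε)) 0 1 U g := by
  unfold periodicEnergy pathEnergy
  rw [intervalIntegral.integral_of_le zero_le_one, integral_Ioc_eq_integral_Ioo]
  refine integral_congr_ae ?_
  filter_upwards [hU, hg] with t h1 h2
  rw [h1, h2]

/-- The lower bound of the energy at a level `lam`: the homogenized cost, up to an error of order
`ε`. -/
theorem le_pathEnergy_div (hV : Continuous V) (hper : Function.Periodic V 1) (hM : ∀ x, V x ≤ M)
    (hlam : ∀ x, lam ≤ V x) {ε : ℝ} (hε : 0 < ε) {a b : ℝ} (hab : a ≤ b) {U g : ℝ → ℝ}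
    (h : IsPrimitive a b U g) :
    lam * (b - a) + crossingCost V lam * |U b - U a| - ε * crossingCost V lam ≤
      pathEnergy (fun x => V (x / ε)) a b U g := by
  have h1 := h.le_pathEnergy (V := fun x => V (x / ε)) hab (hV.comp (continuous_id.div_const ε))
    (fun x => hM _) (fun x => hlam _)
  have h2 := (abs_le.mp (abs_crossing_sub_le hV hper lam hε (U a) (U b))).1
  linarith

theorem IsPrimitive.sum_pathEnergy {a b : ℝ} {U g : ℝ → ℝ} (h : IsPrimitive a b U g)
    (hV : Continuous V) {x : ℕ → ℝ} (hx : Monotone x) (ha : a ≤ x 0) {N : ℕ} (hb : x N ≤ b) :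
    ∑ i ∈ Finset.range N, pathEnergy V (x i) (x (i + 1)) U g = pathEnergy V (x 0) (x N) U g := by
  refine intervalIntegral.sum_integral_adjacent_intervals fun i hi => ?_
  exact (h.mono (ha.trans (hx (Nat.zero_le i))) (hx (Nat.le_succ i))
    ((hx (Nat.succ_le_of_lt hi)).trans hb)).intervalIntegrable_energy (hx (Nat.le_succ i)) hV

theorem monotone_div_nat (N : ℕ) : Monotone fun i : ℕ => (i : ℝ) / N := fun _ _ hij =>
  div_le_div_of_nonneg_right (Nat.cast_le.mpr hij) (Nat.cast_nonneg N)

/-- The liminf inequality, for the piecewise affine interpolation of the limit. -/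
theorem sum_fhom_le_of_frequently (hV : Continuous V) (hper : Function.Periodic V 1)
    {ε : ℕ → ℝ} (hε : Tendsto ε atTop (𝓝[>] 0)) {P p : ℕ → ℝ → ℝ}
    (hP : ∀ n, IsPrimitive 0 1 (P n) (p n)) {U : ℝ → ℝ}
    (hPU : ∀ t ∈ Icc (0 : ℝ) 1, Tendsto (fun n => P n t - P n 0) atTop (𝓝 (U t - U 0))) {c : ℝ}
    (hc : ∃ᶠ n in atTop, pathEnergy (fun x => V (x / ε n)) 0 1 (P n) (p n) ≤ c)
    {N : ℕ} (hN : 0 < N) :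
    ∑ i ∈ Finset.range N, 1 / (N : ℝ) *
      fhom V (N * (U ((i + 1 : ℕ) / N) - U (i / N))) ≤ c := by
  obtain ⟨M, hM⟩ := hper.exists_max hV
  have hN' : (0 : ℝ) < N := Nat.cast_pos.mpr hN
  set x : ℕ → ℝ := fun i => (i : ℝ) / N with hx
  have hxm : Monotone x := monotone_div_nat N
  have hx0 : x 0 = 0 := by simp [hx]
  have hxN : x N = 1 := div_self hN'.ne'
  have hx01 (i : ℕ) (hi : i ≤ N) : x i ∈ Icc (0 : ℝ) 1 :=
    ⟨hx0 ▸ hxm (Nat.zero_le i), hxN ▸ hxm hi⟩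
  have hstep (i : ℕ) : x (i + 1) - x i = 1 / N := by
    simp only [hx]
    push_cast
    ring
  -- the level that is optimal for the mean slope of `U` on each interval
  choose l hl hlf using fun i : ℕ => exists_fhom_eq hV hper (N * (U (x (i + 1)) - U (x i)))
  have hval (i : ℕ) : 1 / (N : ℝ) * fhom V (N * (U (x (i + 1)) - U (x i))) =
      l i * (x (i + 1) - x i) + crossingCost V (l i) * |U (x (i + 1)) - U (x i)| := by
    rw [hlf, hstep, abs_mul, abs_of_pos hN']
    field_simp
  have hlow (n : ℕ) (hn : 0 < ε n) :
      ∑ i ∈ Finset.range N, (l i * (x (i + 1) - x i) + crossingCost V (l i) *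
        |P n (x (i + 1)) - P n (x i)| - ε n * crossingCost V (l i)) ≤
      pathEnergy (fun y => V (y / ε n)) 0 1 (P n) (p n) := by
    have hs := (hP n).sum_pathEnergy (V := fun y => V (y / ε n))
      (hV.comp (continuous_id.div_const _)) hxm hx0.ge hxN.le
    rw [hx0, hxN] at hs
    rw [← hs]
    refine Finset.sum_le_sum fun i hi => ?_
    have hi' := Finset.mem_range.mp hi
    exact le_pathEnergy_div hV hper hM (hl i) hn (hxm (Nat.le_succ i))
      ((hP n).mono (hx01 i hi'.le).1 (hxm (Nat.le_succ i)) (hx01 (i + 1) hi').2)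
  have hε0 : Tendsto ε atTop (𝓝 0) := hε.mono_right nhdsWithin_le_nhds
  have hεpos : ∀ᶠ n in atTop, 0 < ε n := hε.eventually self_mem_nhdsWithin
  have hlim : Tendsto (fun n => ∑ i ∈ Finset.range N, (l i * (x (i + 1) - x i) +
      crossingCost V (l i) * |P n (x (i + 1)) - P n (x i)| - ε n * crossingCost V (l i))) atTop
      (𝓝 (∑ i ∈ Finset.range N, (l i * (x (i + 1) - x i) + crossingCost V (l i) *
        |U (x (i + 1)) - U (x i)| - 0 * crossingCost V (l i)))) := by
    refine tendsto_finsetSum _ fun i hi => ?_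
    have hi' := Finset.mem_range.mp hi
    have h1 := (hPU _ (hx01 (i + 1) hi')).sub (hPU _ (hx01 i hi'.le))
    simp only [sub_sub_sub_cancel_right] at h1
    exact ((h1.abs.const_mul _).const_add _).sub (hε0.mul_const _)
  have hle := le_of_tendsto_of_frequently hlim
    ((hc.and_eventually hεpos).mono fun n hn => (hlow n hn.2).trans hn.1)
  refine le_trans (le_of_eq ?_) hle
  refine Finset.sum_congr rfl fun i _ => ?_
  rw [zero_mul, sub_zero]
  exact hval i

/-- At a point of differentiability, the slopes over the intervals of the uniform partitions that
contain the point converge to the derivative. -/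
theorem HasDerivAt.tendsto_floor_slope {f : ℝ → ℝ} {f' t : ℝ} (h : HasDerivAt f f' t)
    (ht : 0 ≤ t) :
    Tendsto (fun n : ℕ => ((n + 1 : ℕ) : ℝ) * (f ((⌊((n + 1 : ℕ) : ℝ) * t⌋₊ + 1 : ℕ) / (n + 1 : ℕ)) -
      f (⌊((n + 1 : ℕ) : ℝ) * t⌋₊ / (n + 1 : ℕ)))) atTop (𝓝 f') := by
  rw [Metric.tendsto_atTop]
  intro δ hδ
  rw [hasDerivAt_iff_isLittleO, Asymptotics.isLittleO_iff] at h
  obtain ⟨ρ, hρ, hball⟩ := Metric.eventually_nhds_iff.mp (h (half_pos hδ))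
  obtain ⟨n₀, hn₀⟩ := exists_nat_one_div_lt hρ
  refine ⟨n₀, fun n hn => ?_⟩
  set N : ℝ := ((n + 1 : ℕ) : ℝ) with hN
  have hN0 : 0 < N := by positivity
  have hNρ : 1 / N < ρ := by
    refine lt_of_le_of_lt ?_ hn₀
    refine one_div_le_one_div_of_le (by positivity) ?_
    rw [hN]
    push_cast
    have : (n₀ : ℝ) ≤ n := Nat.cast_le.mpr hn
    linarith
  set k : ℕ := ⌊N * t⌋₊ with hk
  have hk1 : (k : ℝ) ≤ N * t := Nat.floor_le (by positivity)
  have hk2 : N * t < k + 1 := Nat.lt_floor_add_one _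
  have hx : (k : ℝ) / N ≤ t := by rw [div_le_iff₀ hN0]; linarith
  have hy : t < ((k + 1 : ℕ) : ℝ) / N := by rw [lt_div_iff₀ hN0]; push_cast; linarith
  have hxy : ((k + 1 : ℕ) : ℝ) / N - k / N = 1 / N := by push_cast; ring
  have h1 := hball (y := (k : ℝ) / N) (by rw [Real.dist_eq, abs_lt]; constructor <;> linarith)
  have h2 := hball (y := ((k + 1 : ℕ) : ℝ) / N)
    (by rw [Real.dist_eq, abs_lt]; constructor <;> linarith)
  rw [Real.norm_eq_abs, Real.norm_eq_abs, smul_eq_mul] at h1 h2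
  rw [abs_of_nonpos (by linarith : (k : ℝ) / N - t ≤ 0)] at h1
  rw [abs_of_pos (by linarith : 0 < ((k + 1 : ℕ) : ℝ) / N - t)] at h2
  rw [abs_le] at h1 h2
  have h3 : N * (1 / N) = 1 := mul_one_div_cancel hN0.ne'
  rw [Real.dist_eq]
  have h4 : N * (f (((k + 1 : ℕ) : ℝ) / N) - f (k / N)) - f' =
      N * ((f (((k + 1 : ℕ) : ℝ) / N) - f t - (((k + 1 : ℕ) : ℝ) / N - t) * f') -
        (f (k / N) - f t - (k / N - t) * f')) := by
    have : f' = N * (((k + 1 : ℕ) : ℝ) / N - k / N) * f' := by rw [hxy, h3, one_mul]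
    nth_rewrite 1 [this]
    ring
  rw [h4, abs_mul, abs_of_pos hN0]
  have h5 : |(f (((k + 1 : ℕ) : ℝ) / N) - f t - (((k + 1 : ℕ) : ℝ) / N - t) * f') -
      (f (k / N) - f t - (k / N - t) * f')| ≤ δ / 2 * (1 / N) := by
    rw [← hxy, abs_le]
    constructor <;> nlinarith [h1.1, h1.2, h2.1, h2.2]
  calc _ ≤ N * (δ / 2 * (1 / N)) := mul_le_mul_of_nonneg_left h5 hN0.le
    _ = δ / 2 := by rw [mul_comm (δ / 2), ← mul_assoc, h3, one_mul]
    _ < δ := by linarith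

/-- Fatou's lemma for functions bounded below by a constant. -/
theorem integral_le_of_tendsto_of_forall_le {α : Type*} [MeasurableSpace α] {μ : Measure α}
    [IsFiniteMeasure μ] {F : ℕ → α → ℝ} {f : α → ℝ} (hF : ∀ n, Integrable (F n) μ)
    (hf : Integrable f μ) (hm : ∀ n x, m ≤ F n x)
    (hlim : ∀ᵐ x ∂μ, Tendsto (fun n => F n x) atTop (𝓝 (f x))) {c : ℝ}
    (hc : ∀ n, ∫ x, F n x ∂μ ≤ c) : ∫ x, f x ∂μ ≤ c := by
  have hmi : Integrable (fun _ : α => m) μ := integrable_const m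
  have hFs (n : ℕ) : Integrable (fun x => F n x - m) μ := (hF n).sub hmi
  have hfs : Integrable (fun x => f x - m) μ := hf.sub hmi
  have hmf : ∀ᵐ x ∂μ, m ≤ f x := by
    filter_upwards [hlim] with x hx
    exact ge_of_tendsto' hx fun n => hm n x
  have h1 (n : ℕ) : ∫⁻ x, ENNReal.ofReal (F n x - m) ∂μ ≤ ENNReal.ofReal (c - ∫ _, m ∂μ) := by
    rw [← ofReal_integral_eq_lintegral_ofReal (hFs n)
      (ae_of_all _ fun x => sub_nonneg.mpr (hm n x)), integral_sub (hF n) hmi]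
    exact ENNReal.ofReal_le_ofReal (by linarith [hc n])
  have h2 : ∫⁻ x, ENNReal.ofReal (f x - m) ∂μ ≤ ENNReal.ofReal (c - ∫ _, m ∂μ) := by
    calc ∫⁻ x, ENNReal.ofReal (f x - m) ∂μ
        = ∫⁻ x, liminf (fun n => ENNReal.ofReal (F n x - m)) atTop ∂μ := by
          refine lintegral_congr_ae ?_
          filter_upwards [hlim] with x hx
          exact (((ENNReal.continuous_ofReal.tendsto _).comp (hx.sub_const m)).liminf_eq).symm
      _ ≤ liminf (fun n => ∫⁻ x, ENNReal.ofReal (F n x - m) ∂μ) atTop :=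
          lintegral_liminf_le' fun n => (hFs n).aestronglyMeasurable.aemeasurable.ennreal_ofReal
      _ ≤ _ := liminf_le_of_frequently_le' (Frequently.of_forall h1)
  have h0 : 0 ≤ c - ∫ _, m ∂μ := by
    have := integral_mono hmi (hF 0) fun x => hm 0 x
    linarith [hc 0]
  rw [← ofReal_integral_eq_lintegral_ofReal hfs
    (hmf.mono fun x hx => sub_nonneg.mpr hx), integral_sub hf hmi,
    ENNReal.ofReal_le_ofReal_iff h0] at h2
  linarith

/-- The integral of a step function over a uniform partition. -/
theorem integral_floor_comp (G : ℕ → ℝ) {N : ℕ} (hN : 0 < N) :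
    IntegrableOn (fun t : ℝ => G ⌊(N : ℝ) * t⌋₊) (Ioo 0 1) ∧
      ∫ t in Ioo (0 : ℝ) 1, G ⌊(N : ℝ) * t⌋₊ = ∑ i ∈ Finset.range N, 1 / (N : ℝ) * G i := by
  have hN' : (0 : ℝ) < N := Nat.cast_pos.mpr hN
  set x : ℕ → ℝ := fun i => (i : ℝ) / N with hx
  have hxm : Monotone x := monotone_div_nat N
  have hfl (i : ℕ) (t : ℝ) (ht : t ∈ Ioo (x i) (x (i + 1))) : G ⌊(N : ℝ) * t⌋₊ = G i := by
    congr 1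
    have h1 := (div_lt_iff₀ hN').mp ht.1
    have h2 := (lt_div_iff₀ hN').mp ht.2
    push_cast at h2
    rw [Nat.floor_eq_iff (by nlinarith [Nat.cast_nonneg (α := ℝ) i])]
    constructor <;> linarith
  have hint (i : ℕ) : IntervalIntegrable (fun t : ℝ => G ⌊(N : ℝ) * t⌋₊) volume (x i) (x (i + 1)) := by
    rw [intervalIntegrable_iff_integrableOn_Ioo_of_le (hxm (Nat.le_succ i))]
    exact (integrableOn_congr_fun (fun t ht => hfl i t ht) measurableSet_Ioo).mpr
      (integrableOn_const (by simp))
  have hval (i : ℕ) : ∫ t in x i..x (i + 1), G ⌊(N : ℝ) * t⌋₊ = 1 / (N : ℝ) * G i := by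
    rw [intervalIntegral.integral_of_le (hxm (Nat.le_succ i)), integral_Ioc_eq_integral_Ioo,
      setIntegral_congr_fun measurableSet_Ioo (hfl i), ← integral_Ioc_eq_integral_Ioo,
      ← intervalIntegral.integral_of_le (hxm (Nat.le_succ i)), intervalIntegral.integral_const,
      smul_eq_mul]
    congr 1
    simp only [hx]
    push_cast
    ring
  have h0 : x 0 = 0 := by simp [hx]
  have h1 : x N = 1 := div_self hN'.ne'
  have hI := IntervalIntegrable.trans_iterate (n := N) fun i _ => hint i
  have hS := intervalIntegral.sum_integral_adjacent_intervals (n := N) fun i _ => hint i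
  rw [h0, h1] at hI hS
  refine ⟨(intervalIntegrable_iff_integrableOn_Ioo_of_le zero_le_one).mp hI, ?_⟩
  rw [← integral_Ioc_eq_integral_Ioo, ← intervalIntegral.integral_of_le zero_le_one, ← hS]
  exact Finset.sum_congr rfl fun i _ => hval i

/-- The liminf inequality along a sequence whose derivatives converge in mean on every interval. -/
theorem homogenizedEnergy_le_of_frequently (hV : Continuous V) (hper : Function.Periodic V 1)
    {ε : ℕ → ℝ} (hε : Tendsto ε atTop (𝓝[>] 0)) {v : ℕ → H1Interval 0 1} {u : H1Interval 0 1}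
    (hvu : ∀ t ∈ Icc (0 : ℝ) 1, Tendsto (fun n => ∫ s in (0 : ℝ)..t, h1Deriv (v n) s) atTop
      (𝓝 (∫ s in (0 : ℝ)..t, h1Deriv u s))) {c : ℝ}
    (hc : ∃ᶠ n in atTop, periodicEnergy V (ε n) (v n) ≤ c) : homogenizedEnergy V u ≤ c := by
  obtain ⟨x₀, -, hmin⟩ := hper.exists_min hV
  choose P hP hPv using fun n => H1Interval.exists_isPrimitive zero_lt_one (v n)
  obtain ⟨U, hU, -⟩ := H1Interval.exists_isPrimitive zero_lt_one u
  set U₀ : ℝ → ℝ := fun t => U 0 + ∫ s in (0 : ℝ)..t, h1Deriv u s with hU₀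
  have hPU (t : ℝ) (ht : t ∈ Icc (0 : ℝ) 1) :
      Tendsto (fun n => P n t - P n 0) atTop (𝓝 (U₀ t - U₀ 0)) := by
    have h1 : U₀ t - U₀ 0 = ∫ s in (0 : ℝ)..t, h1Deriv u s := by simp [hU₀]
    rw [h1]
    refine (hvu t ht).congr fun n => ?_
    rw [(hP n).eq_add_integral t ht]
    ring
  have hc' : ∃ᶠ n in atTop,
      pathEnergy (fun x => V (x / ε n)) 0 1 (P n) (h1Deriv (v n)) ≤ c :=
    hc.mono fun n hn => (periodicEnergy_eq_pathEnergy (v n) (hPv n) (ae_eq_refl _)) ▸ hn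
  refine integral_le_of_tendsto_of_forall_le (m := V x₀)
    (F := fun n t => fhom V (((n + 1 : ℕ) : ℝ) *
      (U₀ ((⌊((n + 1 : ℕ) : ℝ) * t⌋₊ + 1 : ℕ) / (n + 1 : ℕ)) -
        U₀ (⌊((n + 1 : ℕ) : ℝ) * t⌋₊ / (n + 1 : ℕ)))))
    (fun n => (integral_floor_comp (fun i => fhom V (((n + 1 : ℕ) : ℝ) *
      (U₀ ((i + 1 : ℕ) / (n + 1 : ℕ)) - U₀ (i / (n + 1 : ℕ))))) n.succ_pos).1)
    (integrable_fhom_comp hV hper (Lp.memLp _))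
    (fun n t => le_fhom_of_forall_le hV hper hmin _) ?_ fun n => ?_
  · rw [ae_restrict_iff' measurableSet_Ioo]
    filter_upwards [hU.ae_hasDerivAt zero_le_one] with t ht htm
    exact ((continuous_fhom hV hper).tendsto _).comp
      ((ht (Ioo_subset_Icc_self htm)).tendsto_floor_slope htm.1.le)
  · rw [(integral_floor_comp (fun i => fhom V (((n + 1 : ℕ) : ℝ) *
      (U₀ ((i + 1 : ℕ) / (n + 1 : ℕ)) - U₀ (i / (n + 1 : ℕ))))) n.succ_pos).2]
    exact sum_fhom_le_of_frequently hV hper hε hP hPU hc' n.succ_pos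

end LowerBound

/-! ### The upper bound -/

section UpperBound

variable {V W : ℝ → ℝ} {m M : ℝ}

theorem lintegral_Icc_comp_div (F : ℝ → ℝ≥0∞) {ε B : ℝ} (hε : 0 < ε) (hB : 0 < B) :
    ∫⁻ x in Icc (-B) B, F (x / ε) = ENNReal.ofReal B *
      ((∫⁻ s in Icc (-(B / ε)) (B / ε), F s) / ENNReal.ofReal (B / ε)) := by
  have him : (fun x => x / ε) '' Icc (-B) B = Icc (-(B / ε)) (B / ε) := by
    ext y
    simp only [mem_image, mem_Icc]
    constructor
    · rintro ⟨x, ⟨h1, h2⟩, rfl⟩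
      rw [← neg_div]
      exact ⟨div_le_div_of_nonneg_right h1 hε.le, div_le_div_of_nonneg_right h2 hε.le⟩
    · rintro ⟨h1, h2⟩
      rw [← neg_div, div_le_iff₀ hε] at h1
      rw [le_div_iff₀ hε] at h2
      exact ⟨y * ε, ⟨h1, h2⟩, mul_div_cancel_right₀ _ hε.ne'⟩
  have h := lintegral_image_eq_lintegral_abs_deriv_mul (s := Icc (-B) B) (f := fun x => x / ε)
    (f' := fun _ => 1 / ε) measurableSet_Icc
    (fun x _ => ((hasDerivAt_id x).div_const ε).hasDerivWithinAt)
    (fun x _ y _ hxy => (div_left_inj' hε.ne').mp hxy) F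
  rw [him, lintegral_const_mul' _ _ ENNReal.ofReal_ne_top, abs_of_pos (by positivity)] at h
  rw [h, ENNReal.div_eq_inv_mul, ← mul_assoc, ← mul_assoc, ← ENNReal.ofReal_inv_of_pos (by positivity),
    ← ENNReal.ofReal_mul hB.le, ← ENNReal.ofReal_mul (by positivity)]
  have h1 : B * (B / ε)⁻¹ * (1 / ε) = 1 := by field_simp
  rw [h1, ENNReal.ofReal_one, one_mul]

/-- The vanishing mean of `F`, in rescaled variables. -/
theorem tendsto_lintegral_comp_div (F : ℝ → ℝ≥0∞)
    (hF : Tendsto (fun R : ℝ => (∫⁻ s in Icc (-R) R, F s) / ENNReal.ofReal R) atTop (𝓝 0)) {B : ℝ}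
    (hB : 0 < B) :
    Tendsto (fun ε : ℝ => ∫⁻ x in Icc (-B) B, F (x / ε)) (𝓝[>] 0) (𝓝 0) := by
  have h1 : Tendsto (fun ε : ℝ => B / ε) (𝓝[>] 0) atTop :=
    (tendsto_inv_nhdsGT_zero.const_mul_atTop hB).congr fun ε => (div_eq_mul_inv B ε).symm
  have h2 := ENNReal.Tendsto.const_mul (a := ENNReal.ofReal B) (hF.comp h1)
    (Or.inr ENNReal.ofReal_ne_top)
  rw [mul_zero] at h2
  refine h2.congr' ?_
  filter_upwards [self_mem_nhdsWithin] with ε hε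
  exact (lintegral_Icc_comp_div F hε hB).symm

/-- If `W` has a small mean on a window, then the window contains a point that almost minimizes `V`
and at which `W` is small: otherwise `W` would dominate the periodic function `max 0 (m + δ - V)`.
-/
theorem exists_good_point (hV : Continuous V) (hper : Function.Periodic V 1) (hW0 : ∀ x, 0 ≤ W x)
    {x₀ : ℝ} (hx₀ : x₀ ∈ Icc (0 : ℝ) 1) (hmin : ∀ x, V x₀ ≤ V x) {δ : ℝ} (hδ : 0 < δ) :
    ∃ ρ > 0, ∀ ε, 0 < ε → ε ≤ δ → ∀ z,
      ∫⁻ x in Icc (z - δ) (z + δ), ENNReal.ofReal (W (x / ε)) < ENNReal.ofReal ρ →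
      ∃ x ∈ Icc (z - δ) (z + δ), V (x / ε) ≤ V x₀ + δ ∧ W (x / ε) ≤ δ := by
  set ψ : ℝ → ℝ := fun s => max 0 (V x₀ + δ - V s) with hψ
  have hψc : Continuous ψ := continuous_const.max (continuous_const.sub hV)
  have hψper : Function.Periodic ψ 1 := fun s => by simp only [hψ, hper s]
  have hψ0 (s : ℝ) : 0 ≤ ψ s := le_max_left _ _
  set κ := ∫ s in (0 : ℝ)..1, ψ s with hκ
  have hκ0 : 0 < κ := by
    refine intervalIntegral.integral_pos one_pos hψc.continuousOn (fun s _ => hψ0 s) ⟨x₀, hx₀, ?_⟩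
    refine lt_max_of_lt_right ?_
    linarith
  refine ⟨δ * κ, by positivity, fun ε hε hεδ z hz => ?_⟩
  by_contra hcon
  push Not at hcon
  have hle : z - δ ≤ z + δ := by linarith
  have hdom (x : ℝ) (hx : x ∈ Icc (z - δ) (z + δ)) : ψ (x / ε) ≤ W (x / ε) := by
    refine max_le (hW0 _) ?_
    by_cases hVx : V (x / ε) ≤ V x₀ + δ
    · linarith [hcon x hx hVx, hmin (x / ε)]
    · linarith [hW0 (x / ε)]
  have hψε : Continuous fun x => ψ (x / ε) := hψc.comp (continuous_id.div_const ε)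
  have h1 : ENNReal.ofReal (∫ x in (z - δ)..(z + δ), ψ (x / ε)) ≤
      ∫⁻ x in Icc (z - δ) (z + δ), ENNReal.ofReal (W (x / ε)) := by
    rw [intervalIntegral.integral_of_le hle, ← integral_Icc_eq_integral_Ioc,
      ofReal_integral_eq_lintegral_ofReal (hψε.integrableOn_Icc) (ae_of_all _ fun x => hψ0 _)]
    exact setLIntegral_mono' measurableSet_Icc fun x hx => ENNReal.ofReal_le_ofReal (hdom x hx)
  have h2 := (abs_le.mp (hψper.abs_integral_div_sub_le hψc hψ0 hε (z - δ) (z + δ))).1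
  rw [abs_of_nonneg (intervalIntegral.integral_nonneg hle fun x _ => hψ0 _),
    abs_of_nonneg (by linarith)] at h2
  have h3 : δ * κ ≤ ∫ x in (z - δ)..(z + δ), ψ (x / ε) := by nlinarith
  exact (hz.trans_le ((ENNReal.ofReal_le_ofReal h3).trans h1)).false

/-- Concatenation of finitely many paths. -/
theorem exists_concatenation (hV : Continuous V) (F : ℝ → ℝ≥0∞) {t x : ℕ → ℝ} (ht : StrictMono t)
    {R : ℝ → ℝ → Prop} (hR : R (t 0) (x 0)) {E : ℕ → ℝ} {A : ℕ → ℝ≥0∞} {N : ℕ}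
    (h : ∀ i < N, ∃ U g, IsPrimitive (t i) (t (i + 1)) U g ∧ U (t i) = x i ∧
      U (t (i + 1)) = x (i + 1) ∧ (∀ s ∈ Icc (t i) (t (i + 1)), R s (U s)) ∧
      pathEnergy V (t i) (t (i + 1)) U g ≤ E i ∧
      ∫⁻ s in Ioo (t i) (t (i + 1)), F (U s) ≤ A i) :
    ∀ n ≤ N, ∃ U g, IsPrimitive (t 0) (t n) U g ∧ U (t n) = x n ∧
      (∀ s ∈ Icc (t 0) (t n), R s (U s)) ∧
      pathEnergy V (t 0) (t n) U g ≤ ∑ i ∈ Finset.range n, E i ∧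
      ∫⁻ s in Ioo (t 0) (t n), F (U s) ≤ ∑ i ∈ Finset.range n, A i := by
  intro n
  induction n with
  | zero =>
    intro _
    refine ⟨_, _, IsPrimitive.const _ _ (x 0), rfl, fun s hs => ?_, ?_, ?_⟩
    · rw [Icc_self] at hs
      rwa [mem_singleton_iff.mp hs]
    · simp [pathEnergy]
    · simp
  | succ n ih =>
    intro hn
    obtain ⟨U, g, hU, hUn, hUR, hUE, hUA⟩ := ih (Nat.le_of_succ_le hn)
    obtain ⟨P, p, hP, hP0, hP1, hPR, hPE, hPA⟩ := h n hn
    have h0 : t 0 ≤ t n := ht.monotone (Nat.zero_le n)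
    have h1 : t n < t (n + 1) := ht (Nat.lt_succ_self n)
    have hc : U (t n) = P (t n) := hUn.trans hP0.symm
    refine ⟨_, _, hU.glue hP h0 hc, ?_, fun s hs => ?_, ?_, ?_⟩
    · rw [if_neg (not_le.mpr h1), hP1]
    · rcases le_or_gt s (t n) with hsn | hsn
      · simp only [if_pos hsn]
        exact hUR s ⟨hs.1, hsn⟩
      · simp only [if_neg (not_le.mpr hsn)]
        exact hPR s ⟨hsn.le, hs.2⟩
    · rw [pathEnergy_glue hU hP h0 h1.le hc hV, Finset.sum_range_succ]
      exact add_le_add hUE hPE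
    · rw [Finset.sum_range_succ]
      exact (lintegral_Ioo_glue_le F).trans (add_le_add hUA hPA)

/-- Jensen's inequality for the affine minorants of `f_hom`. -/
theorem IsPrimitive.le_integral_fhom (hV : Continuous V) (hper : Function.Periodic V 1) {lam : ℝ}
    (hlam : ∀ x, lam ≤ V x) {a b : ℝ} (hab : a ≤ b) {U g : ℝ → ℝ} (h : IsPrimitive a b U g) :
    lam * (b - a) + crossingCost V lam * |U b - U a| ≤ ∫ t in a..b, fhom V (g t) := by
  have hi := h.intervalIntegrable hab
  have hf : IntervalIntegrable (fun t => fhom V (g t)) volume a b :=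
    (intervalIntegrable_iff_integrableOn_Ioo_of_le hab).mpr (integrable_fhom_comp hV hper h.memLp)
  rw [h.sub_eq_integral hab (left_mem_Icc.mpr hab) (right_mem_Icc.mpr hab)]
  have h1 := intervalIntegral.integral_mono_on hab
    ((intervalIntegrable_const (c := lam)).add (hi.abs.const_mul (crossingCost V lam))) hf
    fun t _ => le_fhom hV hper hlam (g t)
  rw [intervalIntegral.integral_add intervalIntegrable_const (hi.abs.const_mul _),
    intervalIntegral.integral_const, intervalIntegral.integral_const_mul, smul_eq_mul] at h1
  have h2 := mul_le_mul_of_nonneg_left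
    (intervalIntegral.abs_integral_le_integral_abs (μ := volume) (f := g) hab)
    (crossingCost_nonneg V lam)
  linarith

/-- One piece of the recovery path: a connection of two points that are `δ`-close to the values of
`U` at the end points of `[a, a + S]`. -/
theorem exists_recovery_piece (hV : Continuous V) (hper : Function.Periodic V 1)
    (hm : ∀ x, m ≤ V x) (hM : ∀ x, V x ≤ M) (F : ℝ → ℝ≥0∞) {ε η δ B a S : ℝ} (hε : 0 < ε)
    (hη : 0 < η) (hη1 : η ≤ 1) (hS : 0 < S) {U g : ℝ → ℝ} (hU : IsPrimitive a (a + S) U g)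
    {x y : ℝ} (hx : x ∈ Icc (-B) B) (hy : y ∈ Icc (-B) B) (hxU : |x - U a| ≤ δ)
    (hyU : |y - U (a + S)| ≤ δ) (hVx : V (x / ε) ≤ m + δ) (hVy : V (y / ε) ≤ m + δ)
    (hFx : F (x / ε) ≤ ENNReal.ofReal δ) (hFy : F (y / ε) ≤ ENNReal.ofReal δ) :
    ∃ P p, IsPrimitive a (a + S) P p ∧ P a = x ∧ P (a + S) = y ∧
      (∀ t ∈ Icc a (a + S), P t ∈ uIcc x y) ∧
      pathEnergy (fun s => V (s / ε)) a (a + S) P p ≤ (∫ t in a..a + S, fhom V (g t)) +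
        2 * √(M - (m - 1 - (2 * B / S) ^ 2)) * (2 * δ + ε) + (δ + η ^ 2) * S ∧
      ∫⁻ t in Ioo a (a + S), F (P t / ε) ≤ ENNReal.ofReal S * ENNReal.ofReal δ +
        (ENNReal.ofReal η)⁻¹ * ∫⁻ s in Icc (-B) B, F (s / ε) := by
  obtain ⟨lam, hl, hl', P, p, hP, hPa, hPb, hPr, hE, hA⟩ := exists_connection
    (V := fun s => V (s / ε)) (hV.comp (continuous_id.div_const ε)) (fun s => hm _) (fun s => hM _)
    hη (fun s => F (s / ε)) x y a hS
  refine ⟨P, p, hP, hPa, hPb, hPr, hE.trans ?_, hA.trans ?_⟩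
  · have hlam (s : ℝ) : lam ≤ V s := by linarith [hm s, sq_nonneg η]
    have hδ : 0 ≤ δ := (abs_nonneg _).trans hxU
    set C := 2 * √(M - (m - 1 - (2 * B / S) ^ 2)) with hC
    -- the slope of the connection is at most `2 B / S`, which bounds its level from below
    have hcC : crossingCost V lam ≤ C := by
      refine (crossingCost_le hV hM lam).trans ?_
      refine mul_le_mul_of_nonneg_left (Real.sqrt_le_sqrt ?_) zero_le_two
      have h1 : ((y - x) / S) ^ 2 ≤ (2 * B / S) ^ 2 := by
        rw [← sq_abs, abs_div, abs_of_pos hS]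
        have h2 : |y - x| ≤ 2 * B := by
          rw [abs_le]
          constructor <;> linarith [hx.1, hx.2, hy.1, hy.2]
        gcongr
      nlinarith
    have h1 := (abs_le.mp (abs_crossing_sub_le hV hper lam hε x y)).2
    have h2 := hU.le_integral_fhom hV hper hlam (by linarith)
    have h3 : |y - x| ≤ |U (a + S) - U a| + 2 * δ := by
      have h4 : y - x = (U (a + S) - U a) + ((y - U (a + S)) - (x - U a)) := by ring
      rw [h4]
      refine (abs_add_le _ _).trans ?_
      have := abs_sub (y - U (a + S)) (x - U a)
      linarith
    have h5 := mul_le_mul_of_nonneg_left h3 (crossingCost_nonneg V lam)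
    have h6 := mul_le_mul_of_nonneg_right hcC (by linarith : 0 ≤ 2 * δ + ε)
    have h7 : (max (V (x / ε)) (V (y / ε)) - m + η ^ 2) * S ≤ (δ + η ^ 2) * S := by
      refine mul_le_mul_of_nonneg_right ?_ hS.le
      linarith [max_le hVx hVy]
    rw [add_sub_cancel_left] at h2
    nlinarith
  · gcongr
    · exact max_le hFx hFy
    · exact uIcc_subset_Icc hx hy

/-- The limsup inequality up to an error `γ`: the recovery path joins good points close to the
graph of `U` over a uniform partition. -/
theorem eventually_exists_recovery (hV : Continuous V) (hper : Function.Periodic V 1)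
    (hW0 : ∀ x, 0 ≤ W x)
    (hWlim : Tendsto
      (fun R : ℝ => (∫⁻ s in Icc (-R) R, ENNReal.ofReal (W s)) / ENNReal.ofReal R) atTop (𝓝 0))
    {U g : ℝ → ℝ} (hU : IsPrimitive 0 1 U g) {γ : ℝ} (hγ : 0 < γ) :
    ∀ᶠ ε in 𝓝[>] 0, ∃ P p, IsPrimitive 0 1 P p ∧ (∀ t ∈ Icc (0 : ℝ) 1, |P t - U t| ≤ γ) ∧
      pathEnergy (fun s => V (s / ε)) 0 1 P p ≤ (∫ t in (0 : ℝ)..1, fhom V (g t)) + γ ∧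
      ∫⁻ t in Ioo (0 : ℝ) 1, ENNReal.ofReal (W (P t / ε)) ≤ ENNReal.ofReal γ := by
  obtain ⟨M, hM⟩ := hper.exists_max hV
  obtain ⟨x₀, hx₀, hmin⟩ := hper.exists_min hV
  have hUc := hU.continuousOn zero_le_one
  obtain ⟨B₀, hB₀⟩ := isCompact_Icc.exists_bound_of_continuousOn hUc
  have hB₀0 : 0 ≤ B₀ := (norm_nonneg _).trans (hB₀ 0 (left_mem_Icc.mpr zero_le_one))
  obtain ⟨r, hr, hUr⟩ := Metric.uniformContinuousOn_iff_le.mp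
    (isCompact_Icc.uniformContinuousOn_of_continuous hUc) (γ / 4) (by positivity)
  obtain ⟨n, hn⟩ := exists_nat_one_div_lt hr
  set N : ℕ := n + 1 with hN
  have hN' : (0 : ℝ) < N := by positivity
  have hNr : 1 / (N : ℝ) < r := by rw [hN]; exact_mod_cast hn
  set B := B₀ + 1 with hB
  -- a bound of the crossing costs that does not depend on `η`, `δ` and `ε`
  set C := 2 * √(M - (V x₀ - 1 - (2 * B / (1 / (N : ℝ))) ^ 2)) with hC
  have hC0 : 0 ≤ C := by positivity
  -- the parameters: `η` is the minimal speed, `δ` the tolerance for the good points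
  obtain ⟨η, hη, hη1, hηγ⟩ : ∃ η : ℝ, 0 < η ∧ η ≤ 1 ∧ η ^ 2 ≤ γ / 4 := by
    refine ⟨min 1 (γ / 4), by positivity, min_le_left _ _, ?_⟩
    have h0 : 0 < min 1 (γ / 4) := by positivity
    nlinarith [min_le_left 1 (γ / 4), min_le_right 1 (γ / 4)]
  obtain ⟨δ, hδ, hδ1, hδγ, hδC⟩ : ∃ δ : ℝ, 0 < δ ∧ δ ≤ 1 ∧ δ ≤ γ / 4 ∧ N * C * (2 * δ) ≤ γ / 4 := by
    refine ⟨min (min 1 (γ / 4)) (γ / (8 * (N * C + 1))), by positivity,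
      (min_le_left _ _).trans (min_le_left _ _), (min_le_left _ _).trans (min_le_right _ _), ?_⟩
    have h1 : N * C * (2 * (γ / (8 * (N * C + 1)))) ≤ γ / 4 := by
      have h2 : N * C * (2 * (γ / (8 * (N * C + 1)))) = γ / 4 * (N * C / (N * C + 1)) := by
        field_simp
        ring
      rw [h2]
      refine mul_le_of_le_one_right (by positivity) ((div_le_one (by positivity)).mpr (by linarith))
    refine le_trans ?_ h1
    have h3 := min_le_right (min 1 (γ / 4)) (γ / (8 * (N * C + 1)))
    gcongr
  obtain ⟨ρ, hρ, hgood⟩ := exists_good_point hV hper hW0 hx₀ hmin hδ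
  set F : ℝ → ℝ≥0∞ := fun s => ENNReal.ofReal (W s) with hF
  have hω := tendsto_lintegral_comp_div F hWlim (B := B) (by positivity)
  have hω' : Tendsto (fun ε : ℝ => (N : ℝ≥0∞) * ((ENNReal.ofReal η)⁻¹ *
      ∫⁻ x in Icc (-B) B, F (x / ε))) (𝓝[>] 0) (𝓝 0) := by
    have h1 := ENNReal.Tendsto.const_mul (a := (ENNReal.ofReal η)⁻¹) hω
      (Or.inr (by simpa using hη))
    have h2 := ENNReal.Tendsto.const_mul (a := (N : ℝ≥0∞)) h1 (Or.inr (ENNReal.natCast_ne_top N))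
    rwa [mul_zero, mul_zero] at h2
  have hε1 : ∀ᶠ ε : ℝ in 𝓝[>] 0, ε ≤ δ :=
    nhdsWithin_le_nhds ((eventually_lt_nhds hδ).mono fun _ h => h.le)
  have hε2 : ∀ᶠ ε : ℝ in 𝓝[>] 0, N * C * ε < γ / 4 := by
    have h1 : Tendsto (fun ε : ℝ => N * C * ε) (𝓝[>] 0) (𝓝 (N * C * 0)) :=
      (tendsto_id.const_mul _).mono_left nhdsWithin_le_nhds
    rw [mul_zero] at h1
    exact h1.eventually_lt_const (by positivity)
  filter_upwards [self_mem_nhdsWithin, hε1, hε2, hω.eventually_lt_const (ENNReal.ofReal_pos.mpr hρ),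
    hω'.eventually_lt_const (ENNReal.ofReal_pos.mpr (half_pos hγ))] with ε hε hεδ hεC hερ hεγ
  set t : ℕ → ℝ := fun i => (i : ℝ) / N with ht
  have htm : StrictMono t := fun i j hij => div_lt_div_of_pos_right (Nat.cast_lt.mpr hij) hN'
  have ht0 : t 0 = 0 := by simp [ht]
  have htN : t N = 1 := div_self hN'.ne'
  have hstep (i : ℕ) : t (i + 1) = t i + 1 / N := by
    simp only [ht]
    push_cast
    ring
  have ht01 (i : ℕ) (hi : i ≤ N) : t i ∈ Icc (0 : ℝ) 1 :=
    ⟨ht0 ▸ htm.monotone (Nat.zero_le i), htN ▸ htm.monotone hi⟩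
  have hUB (i : ℕ) (hi : i ≤ N) : |U (t i)| ≤ B₀ := hB₀ _ (ht01 i hi)
  have hx : ∀ i, ∃ x, i ≤ N → x ∈ Icc (-B) B ∧ |x - U (t i)| ≤ δ ∧ V (x / ε) ≤ V x₀ + δ ∧
      W (x / ε) ≤ δ := by
    intro i
    by_cases hi : i ≤ N
    · have hsub : Icc (U (t i) - δ) (U (t i) + δ) ⊆ Icc (-B) B := by
        have := abs_le.mp (hUB i hi)
        exact Icc_subset_Icc (by linarith) (by linarith)
      obtain ⟨x, hx, hVx, hWx⟩ := hgood ε hε hεδ (U (t i)) ((lintegral_mono_set hsub).trans_lt hερ)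
      refine ⟨x, fun _ => ⟨hsub hx, ?_, hVx, hWx⟩⟩
      rw [abs_le]
      constructor <;> linarith [hx.1, hx.2]
    · exact ⟨0, fun h => absurd h hi⟩
  choose x hx using hx
  have hclose (i : ℕ) (hi : i ≤ N) {s : ℝ} (hs : s ∈ Icc (0 : ℝ) 1) (hsi : |t i - s| ≤ 1 / N) :
      |x i - U s| ≤ γ := by
    have h1 := hUr (t i) (ht01 i hi) s hs (hsi.trans hNr.le)
    rw [Real.dist_eq] at h1
    have h2 := abs_sub_le (x i) (U (t i)) (U s)
    linarith [(hx i hi).2.1]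
  obtain ⟨P, p, hP, -, hPR, hPE, hPA⟩ := exists_concatenation (V := fun s => V (s / ε))
    (hV.comp (continuous_id.div_const ε)) (fun s => F (s / ε)) htm (x := x)
    (R := fun s y => |y - U s| ≤ γ) (N := N)
    (E := fun i => (∫ s in t i..t (i + 1), fhom V (g s)) + C * (2 * δ + ε) + (δ + η ^ 2) * (1 / N))
    (A := fun _ => ENNReal.ofReal (1 / N) * ENNReal.ofReal δ +
      (ENNReal.ofReal η)⁻¹ * ∫⁻ s in Icc (-B) B, F (s / ε))
    (hclose 0 (Nat.zero_le N) (ht01 0 (Nat.zero_le N)) (by rw [sub_self, abs_zero]; positivity))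
    (fun i hi => by
      have hi1 := hx i hi.le
      have hi2 := hx (i + 1) hi
      have hUi : IsPrimitive (t i) (t (i + 1)) U g :=
        hU.mono (ht01 i hi.le).1 (htm (Nat.lt_succ_self i)).le (ht01 (i + 1) hi).2
      have h3 := hi2.2.1
      rw [hstep] at hUi h3
      obtain ⟨P, p, hP, hPa, hPb, hPr, hPE, hPA⟩ := exists_recovery_piece hV hper hmin hM F hε hη
        hη1 (one_div_pos.mpr hN') hUi hi1.1 hi2.1 hi1.2.1 h3 hi1.2.2.1 hi2.2.2.1
        (ENNReal.ofReal_le_ofReal hi1.2.2.2) (ENNReal.ofReal_le_ofReal hi2.2.2.2)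
      rw [← hstep] at hP hPb hPr hPE hPA
      refine ⟨P, p, hP, hPa, hPb, fun s hs => ?_, hPE, hPA⟩
      have hs01 : s ∈ Icc (0 : ℝ) 1 :=
        ⟨(ht01 i hi.le).1.trans hs.1, hs.2.trans (ht01 (i + 1) hi).2⟩
      have hst := hstep i
      have h4 := abs_le.mp (hclose i hi.le hs01 (by
        rw [abs_le]; constructor <;> linarith [hs.1, hs.2, one_div_pos.mpr hN']))
      have h5 := abs_le.mp (hclose (i + 1) hi hs01 (by
        rw [abs_le]; constructor <;> linarith [hs.1, hs.2, one_div_pos.mpr hN']))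
      have h6 : P s ∈ Icc (U s - γ) (U s + γ) :=
        uIcc_subset_Icc ⟨by linarith, by linarith⟩ ⟨by linarith, by linarith⟩ (hPr s hs)
      rw [abs_le]
      constructor <;> linarith [h6.1, h6.2]) N le_rfl
  rw [ht0, htN] at hP hPR hPE hPA
  refine ⟨P, p, hP, hPR, hPE.trans ?_, hPA.trans ?_⟩
  · have hfi : IntervalIntegrable (fun s => fhom V (g s)) volume 0 1 :=
      (intervalIntegrable_iff_integrableOn_Ioo_of_le zero_le_one).mpr
        (integrable_fhom_comp hV hper hU.memLp)
    have hsum : ∑ i ∈ Finset.range N, ∫ s in t i..t (i + 1), fhom V (g s) =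
        ∫ s in (0 : ℝ)..1, fhom V (g s) := by
      rw [intervalIntegral.sum_integral_adjacent_intervals, ht0, htN]
      intro i hi
      refine hfi.mono_set ?_
      rw [uIcc_of_le zero_le_one, uIcc_of_le (htm (Nat.lt_succ_self i)).le]
      exact Icc_subset_Icc (ht01 i hi.le).1 (ht01 (i + 1) hi).2
    rw [Finset.sum_add_distrib, Finset.sum_add_distrib, hsum, Finset.sum_const, Finset.sum_const,
      Finset.card_range, nsmul_eq_mul, nsmul_eq_mul]
    have h1 : (N : ℝ) * ((δ + η ^ 2) * (1 / N)) = δ + η ^ 2 := by field_simp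
    rw [h1]
    linarith
  · rw [Finset.sum_const, Finset.card_range, nsmul_eq_mul, mul_add, ← mul_assoc,
      ← ENNReal.ofReal_natCast N, ← ENNReal.ofReal_mul hN'.le, mul_one_div_cancel hN'.ne',
      ENNReal.ofReal_one, one_mul, ENNReal.ofReal_natCast]
    refine (add_le_add (ENNReal.ofReal_le_ofReal (by linarith : δ ≤ γ / 2)) hεγ.le).trans ?_
    rw [← ENNReal.ofReal_add (by positivity) (by positivity), add_halves]

end UpperBound

/-! ### Weak convergence and recovery sequences -/

section Convergence

variable {V W : ℝ → ℝ} {m M : ℝ}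

theorem IsTestFunction.memLp {a b : ℝ} {φ : ℝ → ℝ} (h : IsTestFunction a b φ) :
    MemLp φ 2 (volume.restrict (Ioo a b)) :=
  h.smooth.continuous.memLp_of_hasCompactSupport h.compact

/-- The test functions are dense in `L²`. -/
theorem L2Interval.eq_zero_of_inner_test_eq_zero {a b : ℝ} {f : L2Interval a b}
    (h : ∀ (φ : ℝ → ℝ) (hφ : IsTestFunction a b φ), inner ℝ (hφ.memLp.toLp φ) f = 0) : f = 0 := by
  have hloc : LocallyIntegrableOn f (Ioo a b) volume :=
    IntegrableOn.locallyIntegrableOn ((Lp.memLp f).integrable (by norm_num))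
  have key := isOpen_Ioo.ae_eq_zero_of_integral_contDiff_smul_eq_zero hloc fun φ h1 h2 h3 => by
    have hφ : IsTestFunction a b φ := ⟨h1, h2, h3⟩
    rw [← h φ hφ, L2Interval.inner_eq_integral,
      ← setIntegral_eq_integral_of_forall_compl_eq_zero (s := Ioo a b)]
    · exact integral_congr_ae (hφ.memLp.coeFn_toLp.mono fun t ht => by simp only [ht, smul_eq_mul])
    · intro t ht
      rw [image_eq_zero_of_notMem_tsupport fun h => ht (h3 h), zero_smul]
  rw [Lp.eq_zero_iff_ae_eq_zero]
  exact (ae_restrict_iff' measurableSet_Ioo).mpr key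

/-- In `L²`, a bounded sequence converges weakly to zero if it does so against test functions. -/
theorem L2Interval.tendsto_inner_of_bounded {a b : ℝ} {w : ℕ → L2Interval a b} {C : ℝ}
    (hC : ∀ᶠ n in atTop, ‖w n‖ ≤ C)
    (h : ∀ (φ : ℝ → ℝ) (hφ : IsTestFunction a b φ),
      Tendsto (fun n => inner ℝ (hφ.memLp.toLp φ) (w n)) atTop (𝓝 0)) (q : L2Interval a b) :
    Tendsto (fun n => inner ℝ q (w n)) atTop (𝓝 0) := by
  let D : Submodule ℝ (L2Interval a b) :=
    { carrier := {q | Tendsto (fun n => inner ℝ q (w n)) atTop (𝓝 0)}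
      zero_mem' := by simp
      add_mem' := fun {p q} hp hq => by
        have hp' : Tendsto (fun n => inner ℝ p (w n)) atTop (𝓝 0) := hp
        have hq' : Tendsto (fun n => inner ℝ q (w n)) atTop (𝓝 0) := hq
        have := hp'.add hq'
        simpa only [mem_ofPred_eq, inner_add_left, add_zero] using this
      smul_mem' := fun c q hq => by
        have hq' : Tendsto (fun n => inner ℝ q (w n)) atTop (𝓝 0) := hq
        have := hq'.const_mul c
        simpa only [mem_ofPred_eq, real_inner_smul_left, mul_zero] using this }
  have hbot : Dᗮ = ⊥ := by
    rw [Submodule.eq_bot_iff]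
    intro f hf
    refine L2Interval.eq_zero_of_inner_test_eq_zero fun φ hφ => ?_
    exact (Submodule.mem_orthogonal D f).mp hf _ (h φ hφ)
  have hq : q ∈ closure (D : Set (L2Interval a b)) := by
    rw [← Submodule.topologicalClosure_coe, (D.topologicalClosure_eq_top_iff).mpr hbot]
    trivial
  have hC0 : 0 ≤ C := by
    obtain ⟨n, hn⟩ := hC.exists
    exact (norm_nonneg _).trans hn
  rw [Metric.tendsto_nhds]
  intro γ hγ
  obtain ⟨q', hq', hqq'⟩ := Metric.mem_closure_iff.mp hq (γ / (2 * (C + 1))) (by positivity)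
  have hq'' : Tendsto (fun n => inner ℝ q' (w n)) atTop (𝓝 0) := hq'
  filter_upwards [hC, (Metric.tendsto_nhds.mp hq'') (γ / 2) (by positivity)] with n hn hn'
  rw [dist_zero_right] at hn' ⊢
  have h1 : inner ℝ q (w n) = inner ℝ (q - q') (w n) + inner ℝ q' (w n) := by
    rw [inner_sub_left]
    ring
  have h2 : ‖inner ℝ (q - q') (w n)‖ ≤ γ / (2 * (C + 1)) * C := by
    refine (norm_inner_le_norm _ _).trans ?_
    rw [dist_eq_norm] at hqq'
    gcongr
  have h3 : γ / (2 * (C + 1)) * C ≤ γ / 2 := by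
    have : γ / (2 * (C + 1)) * C = γ / 2 * (C / (C + 1)) := by field_simp
    rw [this]
    exact mul_le_of_le_one_right (by positivity) ((div_le_one (by positivity)).mpr (by linarith))
  rw [h1]
  refine (norm_add_le _ _).trans_lt ?_
  linarith

theorem inner_test_h1Deriv {a b : ℝ} (u : H1Interval a b) {φ : ℝ → ℝ} (hφ : IsTestFunction a b φ)
    (hφ' : MemLp (deriv φ) 2 (volume.restrict (Ioo a b))) :
    inner ℝ (hφ.memLp.toLp φ) (h1Deriv u) = -inner ℝ (hφ'.toLp (deriv φ)) (h1Val u) := by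
  have h : ∫ t in Ioo a b, h1Val u t * deriv φ t = -∫ t in Ioo a b, h1Deriv u t * φ t := u.2 φ hφ
  rw [L2Interval.inner_eq_integral, L2Interval.inner_eq_integral]
  have h1 : ∫ t in Ioo a b, (hφ.memLp.toLp φ) t * h1Deriv u t = ∫ t in Ioo a b, h1Deriv u t * φ t :=
    integral_congr_ae (hφ.memLp.coeFn_toLp.mono fun t ht => by simp only [ht, mul_comm])
  have h2 : ∫ t in Ioo a b, (hφ'.toLp (deriv φ)) t * h1Val u t =
      ∫ t in Ioo a b, h1Val u t * deriv φ t :=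
    integral_congr_ae (hφ'.coeFn_toLp.mono fun t ht => by simp only [ht, mul_comm])
  rw [h1, h2, h, neg_neg]

/-- Strong `L²` convergence with bounded derivatives implies weak convergence in `H¹`. -/
theorem StrongL2Conv.weakH1Conv {a b : ℝ} {v : ℕ → H1Interval a b} {u : H1Interval a b}
    (h : StrongL2Conv a b v u) {C : ℝ} (hC : ∀ᶠ n in atTop, ‖h1Deriv (v n)‖ ≤ C) :
    WeakH1Conv a b v u := by
  have hval : Tendsto (fun n => h1Val (v n)) atTop (𝓝 (h1Val u)) := h
  have hweak (q : L2Interval a b) :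
      Tendsto (fun n => inner ℝ q (h1Deriv (v n))) atTop (𝓝 (inner ℝ q (h1Deriv u))) := by
    have h1 := L2Interval.tendsto_inner_of_bounded (w := fun n => h1Deriv (v n) - h1Deriv u)
      (C := C + ‖h1Deriv u‖)
      (hC.mono fun n hn => (norm_sub_le _ _).trans (by linarith)) (fun φ hφ => by
        have hφ' : MemLp (deriv φ) 2 (volume.restrict (Ioo a b)) :=
          hφ.continuous_deriv.memLp_of_hasCompactSupport hφ.compact.deriv
        simp only [inner_sub_right, inner_test_h1Deriv _ hφ hφ']
        have h2 : Tendsto (fun n => inner ℝ (hφ'.toLp (deriv φ)) (h1Val (v n))) atTop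
            (𝓝 (inner ℝ (hφ'.toLp (deriv φ)) (h1Val u))) := tendsto_const_nhds.inner hval
        have h3 := h2.neg.sub_const (-inner ℝ (hφ'.toLp (deriv φ)) (h1Val u))
        rwa [sub_self] at h3) q
    have h2 := h1.add_const (inner ℝ q (h1Deriv u))
    simp only [inner_sub_right, sub_add_cancel, zero_add] at h2
    exact h2
  intro l
  obtain ⟨g, hg, -⟩ := exists_extension_norm_eq (H1Interval a b) l
  set p := (InnerProductSpace.toDual ℝ (WithLp 2 (L2Interval a b × L2Interval a b))).symm g with hp
  have hl (w : H1Interval a b) : l w = inner ℝ p.fst (h1Val w) + inner ℝ p.snd (h1Deriv w) := by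
    rw [← hg w, ← InnerProductSpace.toDual_symm_apply]
    rfl
  simp only [hl]
  exact (tendsto_const_nhds.inner hval).add (hweak p.snd)

theorem WeakH1Conv.tendsto_integral_h1Deriv {v : ℕ → H1Interval 0 1} {u : H1Interval 0 1}
    (h : WeakH1Conv 0 1 v u) {t : ℝ} (ht : t ∈ Icc (0 : ℝ) 1) :
    Tendsto (fun n => ∫ s in (0 : ℝ)..t, h1Deriv (v n) s) atTop
      (𝓝 (∫ s in (0 : ℝ)..t, h1Deriv u s)) := by
  obtain ⟨l, hl⟩ := exists_clm_eq_integral_h1Deriv (a := 0) (b := 1) (measurableSet_Ioo (a := 0) (b := t))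
  have hl' (w : H1Interval 0 1) : ∫ s in (0 : ℝ)..t, h1Deriv w s = l w := by
    rw [hl, Measure.restrict_restrict measurableSet_Ioo, inter_eq_left.mpr (Ioo_subset_Ioo_right ht.2),
      intervalIntegral.integral_of_le ht.1, integral_Ioc_eq_integral_Ioo]
  simp only [hl']
  exact h l

/-- Coercivity. -/
theorem sq_norm_h1Deriv_le (hV : Continuous V) (hm : ∀ x, m ≤ V x) (ε : ℝ) (u : H1Interval 0 1) :
    ‖h1Deriv u‖ ^ 2 + m ≤ periodicEnergy V ε u := by
  obtain ⟨U, hU, hUu⟩ := H1Interval.exists_isPrimitive zero_lt_one u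
  have h1 := hU.intervalIntegrable_energy zero_le_one (V := fun x => V (x / ε))
    (hV.comp (continuous_id.div_const ε))
  rw [periodicEnergy_eq_pathEnergy u hUu (ae_eq_refl _), ← real_inner_self_eq_norm_sq,
    L2Interval.inner_eq_integral, ← integral_Ioc_eq_integral_Ioo,
    ← intervalIntegral.integral_of_le zero_le_one]
  have hi := hU.intervalIntegrable_sq zero_le_one
  have h2 := intervalIntegral.integral_mono_on zero_le_one
    (hi.add (intervalIntegrable_const (c := m))) h1 fun t _ => by linarith [hm (U t / ε)]
  rw [intervalIntegral.integral_add hi intervalIntegrable_const, intervalIntegral.integral_const,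
    sub_zero, one_smul] at h2
  simp only [← pow_two]
  exact h2

theorem norm_h1Deriv_le_of_periodicEnergy_le (hV : Continuous V) (hm : ∀ x, m ≤ V x) {ε c : ℝ}
    {u : H1Interval 0 1} (h : periodicEnergy V ε u ≤ c) : ‖h1Deriv u‖ ≤ √(c - m) :=
  Real.le_sqrt_of_sq_le (by linarith [sq_norm_h1Deriv_le hV hm ε u])

theorem WeakH1Conv.homogenizedEnergy_le (hV : Continuous V) (hper : Function.Periodic V 1)
    {ε : ℕ → ℝ} (hε : Tendsto ε atTop (𝓝[>] 0)) {v : ℕ → H1Interval 0 1} {u : H1Interval 0 1}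
    (h : WeakH1Conv 0 1 v u) {c : ℝ} (hc : ∃ᶠ n in atTop, periodicEnergy V (ε n) (v n) ≤ c) :
    homogenizedEnergy V u ≤ c :=
  homogenizedEnergy_le_of_frequently hV hper hε (fun _ ht => h.tendsto_integral_h1Deriv ht) hc

/-- Along a subsequence of bounded energy, strong `L²` convergence is weak convergence in `H¹`. -/
theorem StrongL2Conv.homogenizedEnergy_le (hV : Continuous V) (hper : Function.Periodic V 1)
    {ε : ℕ → ℝ} (hε : Tendsto ε atTop (𝓝[>] 0)) {v : ℕ → H1Interval 0 1} {u : H1Interval 0 1}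
    (h : StrongL2Conv 0 1 v u) {c : ℝ} (hc : ∃ᶠ n in atTop, periodicEnergy V (ε n) (v n) ≤ c) :
    homogenizedEnergy V u ≤ c := by
  obtain ⟨x₀, -, hmin⟩ := hper.exists_min hV
  obtain ⟨k, hk, hkc⟩ := extraction_of_frequently_atTop hc
  have h1 : StrongL2Conv 0 1 (fun n => v (k n)) u :=
    Tendsto.comp (g := fun n => h1Val (v n)) h hk.tendsto_atTop
  exact (h1.weakH1Conv (Eventually.of_forall fun n =>
    norm_h1Deriv_le_of_periodicEnergy_le hV hmin (hkc n))).homogenizedEnergy_le hV hper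
      (hε.comp hk.tendsto_atTop) (Frequently.of_forall hkc)

theorem EReal.coe_le_liminf_of_forall_frequently {E : ℕ → EReal} {e : ℝ}
    (h : ∀ c : ℝ, (∃ᶠ n in atTop, E n ≤ c) → e ≤ c) : (e : EReal) ≤ liminf E atTop := by
  by_contra hlt
  obtain ⟨c, hc1, hc2⟩ := EReal.lt_iff_exists_real_btwn.mp (not_le.mp hlt)
  have h1 := h c ((frequently_lt_of_liminf_lt (by isBoundedDefault) hc1).mono fun n hn => hn.le)
  exact absurd (EReal.coe_lt_coe_iff.mp hc2) (not_lt.mpr h1)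

theorem periodicEnergy_le_perturbedEnergy (ε : ℝ) (u : H1Interval 0 1) :
    (periodicEnergy V ε u : EReal) ≤ perturbedEnergy V W ε u :=
  le_add_of_nonneg_right (EReal.coe_ennreal_nonneg _)

/-- Diagonal sequences: at the index `n`, the element is chosen for the largest `k ≤ n` for which
there is one. -/
theorem exists_diagonal {X : Type*} [Nonempty X] {P : ℕ → ℕ → X → Prop}
    (hP : ∀ {k k' : ℕ}, k ≤ k' → ∀ {n x}, P k' n x → P k n x)
    (h : ∀ k, ∀ᶠ n in atTop, ∃ x, P k n x) :
    ∃ x : ℕ → X, ∀ k, ∀ᶠ n in atTop, P k n (x n) := by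
  classical
  have hx (n : ℕ) : ∃ x, (∃ y, P (Nat.findGreatest (fun k => ∃ y, P k n y) n) n y) →
      P (Nat.findGreatest (fun k => ∃ y, P k n y) n) n x := by
    by_cases hy : ∃ y, P (Nat.findGreatest (fun k => ∃ y, P k n y) n) n y
    · exact ⟨hy.choose, fun _ => hy.choose_spec⟩
    · exact ⟨Classical.arbitrary X, fun h => absurd h hy⟩
  choose x hx using hx
  refine ⟨x, fun k => ?_⟩
  filter_upwards [h k, eventually_ge_atTop k] with n hn hkn
  exact hP (Nat.le_findGreatest hkn hn)
    (hx n (Nat.findGreatest_spec (P := fun k => ∃ y, P k n y) hkn hn))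

/-- A common recovery sequence for the perturbed and the unperturbed energies. -/
theorem exists_recovery_sequence (hV : Continuous V) (hper : Function.Periodic V 1)
    (hW0 : ∀ x, 0 ≤ W x)
    (hWlim : Tendsto
      (fun R : ℝ => (∫⁻ s in Icc (-R) R, ENNReal.ofReal (W s)) / ENNReal.ofReal R) atTop (𝓝 0))
    {ε : ℕ → ℝ} (hε : Tendsto ε atTop (𝓝[>] 0)) (u : H1Interval 0 1) :
    ∃ v : ℕ → H1Interval 0 1, StrongL2Conv 0 1 v u ∧ WeakH1Conv 0 1 v u ∧
      limsup (fun n => perturbedEnergy V W (ε n) (v n)) atTop ≤ (homogenizedEnergy V u : EReal) := by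
  obtain ⟨x₀, -, hmin⟩ := hper.exists_min hV
  obtain ⟨U, hU, hUu⟩ := H1Interval.exists_isPrimitive zero_lt_one u
  have hhom : ∫ t in (0 : ℝ)..1, fhom V (h1Deriv u t) = homogenizedEnergy V u := by
    rw [intervalIntegral.integral_of_le zero_le_one, integral_Ioc_eq_integral_Ioo]
    rfl
  set γ : ℕ → ℝ := fun k => 1 / ((k : ℝ) + 1) with hγ
  have hγ0 (k : ℕ) : 0 < γ k := by positivity
  have hγlim : Tendsto γ atTop (𝓝 0) := tendsto_one_div_add_atTop_nhds_zero_nat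
  have hγanti {k k' : ℕ} (hkk : k ≤ k') : γ k' ≤ γ k := by
    have : (k : ℝ) ≤ k' := Nat.cast_le.mpr hkk
    exact one_div_le_one_div_of_le (by positivity) (by linarith)
  obtain ⟨v, hv⟩ := exists_diagonal (X := H1Interval 0 1)
    (P := fun k n v => ‖h1Val v - h1Val u‖ ≤ γ k ∧
      periodicEnergy V (ε n) v ≤ homogenizedEnergy V u + γ k ∧
      ∫⁻ t in Ioo (0 : ℝ) 1, ENNReal.ofReal (W (h1Val v t / ε n)) ≤ ENNReal.ofReal (γ k))
    (fun hkk n x hx => ⟨hx.1.trans (hγanti hkk), hx.2.1.trans (by linarith [hγanti hkk]),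
      hx.2.2.trans (ENNReal.ofReal_le_ofReal (hγanti hkk))⟩)
    (fun k => by
      filter_upwards [hε.eventually (eventually_exists_recovery hV hper hW0 hWlim hU (hγ0 k))]
        with n hn
      obtain ⟨P, p, hP, hPU, hPE, hPW⟩ := hn
      obtain ⟨w, hw1, hw2⟩ := hP.exists_h1 zero_lt_one
      refine ⟨w, ?_, ?_, ?_⟩
      · have hb : ∀ᵐ t ∂(volume.restrict (Ioo (0 : ℝ) 1)), ‖(h1Val w - h1Val u) t‖ ≤ γ k := by
          filter_upwards [Lp.coeFn_sub (h1Val w) (h1Val u), hw1, hUu,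
            ae_restrict_mem measurableSet_Ioo] with t h1 h2 h3 h4
          rw [h1, Pi.sub_apply, h2, h3]
          exact hPU t (Ioo_subset_Icc_self h4)
        have := Lp.norm_le_of_ae_bound (hγ0 k).le hb
        simpa [measureUnivNNReal] using this
      · rw [periodicEnergy_eq_pathEnergy w hw1 hw2, ← hhom]
        exact hPE
      · refine le_trans (le_of_eq (lintegral_congr_ae ?_)) hPW
        filter_upwards [hw1] with t ht
        rw [ht])
  have hstrong : StrongL2Conv 0 1 v u := by
    refine tendsto_iff_norm_sub_tendsto_zero.mpr (Metric.tendsto_nhds.mpr fun r hr => ?_)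
    obtain ⟨k, hk⟩ := (hγlim.eventually_lt_const hr).exists
    filter_upwards [hv k] with n hn
    rw [dist_zero_right, norm_norm]
    exact hn.1.trans_lt hk
  refine ⟨v, hstrong, hstrong.weakH1Conv ((hv 0).mono fun n hn =>
    norm_h1Deriv_le_of_periodicEnergy_le hV hmin hn.2.1), ?_⟩
  refine le_of_forall_gt_imp_ge_of_dense fun c hc => ?_
  obtain ⟨c', hc1, hc2⟩ := EReal.lt_iff_exists_real_btwn.mp hc
  have hc1' := EReal.coe_lt_coe_iff.mp hc1
  obtain ⟨k, hk⟩ := (hγlim.eventually_lt_const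
    (show 0 < (c' - homogenizedEnergy V u) / 2 by linarith)).exists
  refine (limsup_le_of_le (by isBoundedDefault) ((hv k).mono fun n hn => ?_)).trans hc2.le
  have h1 : ((∫⁻ t in Ioo (0 : ℝ) 1, ENNReal.ofReal (W (h1Val (v n) t / ε n)) : ℝ≥0∞) : EReal) ≤
      ((γ k : ℝ) : EReal) := by
    refine (EReal.coe_ennreal_le_coe_ennreal_iff.mpr hn.2.2).trans (le_of_eq ?_)
    rw [EReal.coe_ennreal_ofReal, max_eq_left (hγ0 k).le]
  refine (add_le_add (EReal.coe_le_coe_iff.mpr hn.2.1) h1).trans ?_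
  rw [← EReal.coe_add, EReal.coe_le_coe_iff]
  linarith

end Convergence

end

theorem theorem2p2 (V W : ℝ → ℝ) (hV : Continuous V) (hVper : Function.Periodic V 1)
    (hW : Measurable W) (hW0 : ∀ x, 0 ≤ W x)
    (hWlim : Tendsto
      (fun R : ℝ => (∫⁻ s in Icc (-R) R, ENNReal.ofReal (W s)) / ENNReal.ofReal R)
      atTop (𝓝 0)) :
    -- the homogenized integrand is given by minima, and the homogenized functional is well defined
    IsLeast (range V) (fhom V 0) ∧
    (∀ ξ : ℝ, ξ ≠ 0 → IsLeast (cellEnergy V ξ '' H10Interval 0 (1 / |ξ|)) (fhom V ξ)) ∧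
    (∀ u : H1Interval 0 1,
      Integrable (fun t => fhom V (h1Deriv u t)) (volume.restrict (Ioo (0 : ℝ) 1))) ∧
    -- Γ-convergence in the weak topology of `H¹(0,1)`
    GammaConverges (WeakH1Conv 0 1) (fun ε u => (periodicEnergy V ε u : EReal))
      (fun u => (homogenizedEnergy V u : EReal)) ∧
    GammaConverges (WeakH1Conv 0 1) (perturbedEnergy V W)
      (fun u => (homogenizedEnergy V u : EReal)) ∧
    -- Γ-convergence in the strong topology of `L²(0,1)`
    GammaConverges (StrongL2Conv 0 1) (fun ε u => (periodicEnergy V ε u : EReal))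
      (fun u => (homogenizedEnergy V u : EReal)) ∧
    GammaConverges (StrongL2Conv 0 1) (perturbedEnergy V W)
      (fun u => (homogenizedEnergy V u : EReal)) := by
  have hperturbed {ε : ℕ → ℝ} {v : ℕ → H1Interval 0 1} {c : ℝ}
      (h : ∃ᶠ n in atTop, perturbedEnergy V W (ε n) (v n) ≤ c) :
      ∃ᶠ n in atTop, periodicEnergy V (ε n) (v n) ≤ c :=
    h.mono fun n hn =>
      EReal.coe_le_coe_iff.mp ((periodicEnergy_le_perturbedEnergy _ _).trans hn)
  have hperiodic {ε : ℕ → ℝ} {v : ℕ → H1Interval 0 1} {c : ℝ}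
      (h : ∃ᶠ n in atTop, (periodicEnergy V (ε n) (v n) : EReal) ≤ c) :
      ∃ᶠ n in atTop, periodicEnergy V (ε n) (v n) ≤ c :=
    h.mono fun n hn => EReal.coe_le_coe_iff.mp hn
  have hlimsup {ε : ℕ → ℝ} {v : ℕ → H1Interval 0 1} {e : EReal}
      (h : limsup (fun n => perturbedEnergy V W (ε n) (v n)) atTop ≤ e) :
      limsup (fun n => (periodicEnergy V (ε n) (v n) : EReal)) atTop ≤ e :=
    (limsup_le_limsup (Eventually.of_forall fun n => periodicEnergy_le_perturbedEnergy _ _)).trans h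
  refine ⟨isLeast_range_fhom_zero hV hVper, fun ξ hξ => isLeast_cellEnergy_fhom hV hVper hξ,
    fun u => integrable_fhom_comp hV hVper (Lp.memLp _), fun ε hε u => ?_, fun ε hε u => ?_,
    fun ε hε u => ?_, fun ε hε u => ?_⟩
  all_goals obtain ⟨w, hws, hww, hwl⟩ := exists_recovery_sequence hV hVper hW0 hWlim hε u
  · exact ⟨fun v hv => EReal.coe_le_liminf_of_forall_frequently fun c hc =>
      hv.homogenizedEnergy_le hV hVper hε (hperiodic hc), w, hww, hlimsup hwl⟩
  · exact ⟨fun v hv => EReal.coe_le_liminf_of_forall_frequently fun c hc =>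
      hv.homogenizedEnergy_le hV hVper hε (hperturbed hc), w, hww, hwl⟩
  · exact ⟨fun v hv => EReal.coe_le_liminf_of_forall_frequently fun c hc =>
      hv.homogenizedEnergy_le hV hVper hε (hperiodic hc), w, hws, hlimsup hwl⟩
  · exact ⟨fun v hv => EReal.coe_le_liminf_of_forall_frequently fun c hc =>
      hv.homogenizedEnergy_le hV hVper hε (hperturbed hc), w, hws, hwl⟩
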